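/- Let $X$ and $Y_1,\dots,Y_n$ be finite-dimensional real Hilbert spaces, let $Y=\prod_{i=1}^n Y_i$, and let $X\times Y$ carry the product Hilbert norm. Let $A_i:X\to Y_i$ be linear, and let $g:X\to\mathbb{R}\cup\{\infty\}$ and $f_i:Y_i\to\mathbb{R}\cup\{\infty\}$ be convex, proper and lower semicontinuous, with convex conjugates $f_i^*$. A saddle point is a pair $\hat w=(\hat x,\hat y)\in X\times Y$ such that $L(\hat x,y)\le L(\hat x,\hat y)\le L(x,\hat y)$ for all $x\in X$, $y\in Y$, where $$L(x,y)=\sum_{i=1}^n\big(\langle A_ix,y_i\rangle-f_i^*(y_i)\big)+g(x).$$ Let $p_i>0$ with $\sum_i p_i=1$, and let the step sizes $\tau,\sigma_i>0$ satisfy $\tau\sigma_i\|A_i\|^2<p_i$ for every $i$. Let $j^0,j^1,\dots$ be independent random indices with $\mathbb{P}(j^k=i)=p_i$ for all $k$ and $i$. Write $\mathrm{prox}_{\sigma h}(v)=\arg\min_u \frac12\|v-u\|^2+\sigma h(u)$. Given $x^0\in X$, let $y^{-1}=y^0=0\in Y$, $z^0=\bar z^0=0\in X$, and let the SPDHG iterates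 $w^k=(x^k,y^k)$ be generated, for $k\ge0$, by $$x^{k+1}=\mathrm{prox}_{\tau g}(x^k-\tau\bar z^k),\qquad y_i^{k+1}=\begin{cases}\mathrm{prox}_{\sigma_if_i^*}(y_i^k+\sigma_iA_ix^{k+1}) & i=j^k,\\ y_i^k & i\neq j^k,\end{cases}$$ $$\delta^k=A_{j^k}^T(y_{j^k}^{k+1}-y_{j^k}^k),\qquad z^{k+1}=z^k+\delta^k,\qquad \bar z^{k+1}=z^{k+1}+p_{j^k}^{-1}\delta^k.$$ For $(x,y)\in X\times Y$ let $$V^k(x,y)=\tfrac1\tau\|x\|^2-2\sum_{i=1}^n\tfrac1{p_i}\langle A_ix,y_i^k-y_i^{k-1}\rangle+\sum_{i=1}^n\tfrac{1}{p_i\sigma_i}\|y_i^k-y_i^{k-1}\|^2+\sum_{i=1}^n\tfrac1{p_i\sigma_i}\|y_i\|^2 .$$ Let $\hat w$ be a saddle point. Then: (i) the sequence $(w^k)_{k\in\mathbb{N}}$ is almost surely bounded; (ii) the sequence $(V^k(w^k-\hat w))_{k\in\mathbb{N}}$ converges almost surely (to a finite limit); (iii) the sequence $(\|w^k-\hat w\|)_{k\in\mathbb{N}}$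 converges almost surely; (iv) if almost surely every cluster point of $(w^k)_{k\in\mathbb{N}}$ is a saddle point, then $(w^k)_{k\in\mathbb{N}}$ converges almost surely to a (possibly random) saddle point. -/

import Mathlib

open Filter Topology MeasureTheory ProbabilityTheory
open scoped InnerProductSpace

namespace SPDHG

noncomputable section

section Functionals

variable {E : Type*} [NormedAddCommGroup E] [InnerProductSpace ℝ E]

/-- A functional `f : E → ℝ ∪ {∞}` (with values in the extended reals) is convex, proper and
lower semicontinuous. Convexity is convexity of the epigraph. -/
structure ConvexProperLsc (f : E → EReal) : Prop where
  convex : Convex ℝ {q : E × ℝ | f q.1 ≤ (q.2 : EReal)}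
  ne_bot : ∀ v, f v ≠ ⊥
  exists_ne_top : ∃ v, f v ≠ ⊤
  lsc : LowerSemicontinuous f

/-- The convex conjugate `f^*(y) = sup_v ⟨v, y⟩ - f(v)`. -/
def conj (f : E → EReal) (y : E) : EReal :=
  ⨆ v : E, ((⟪v, y⟫_ℝ : ℝ) : EReal) - f v

/-- `u` is a minimizer of `y ↦ ‖v - y‖² / 2 + σ f(y)`. -/
def IsProx (σ : ℝ) (f : E → EReal) (v u : E) : Prop :=
  ∀ y : E, ((‖v - u‖ ^ 2 / 2 : ℝ) : EReal) + (σ : EReal) * f u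
    ≤ ((‖v - y‖ ^ 2 / 2 : ℝ) : EReal) + (σ : EReal) * f y

/-- The proximity operator `prox_{σ f}(v) = argmin_y ‖v - y‖² / 2 + σ f(y)`. -/
def prox (σ : ℝ) (f : E → EReal) (v : E) : E :=
  Classical.epsilon (IsProx σ f v)

end Functionals

section Problem

variable {n : ℕ} {X : Type*} [NormedAddCommGroup X] [InnerProductSpace ℝ X]
  [FiniteDimensional ℝ X] {Y : Fin n → Type*} [∀ i, NormedAddCommGroup (Y i)]
  [∀ i, InnerProductSpace ℝ (Y i)] [∀ i, FiniteDimensional ℝ (Y i)]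

/-- The saddle function `∑ᵢ (⟨Aᵢ x, yᵢ⟩ - fᵢ^*(yᵢ)) + g(x)`. -/
def saddleFun (A : ∀ i, X →L[ℝ] Y i) (f : ∀ i, Y i → EReal) (g : X → EReal)
    (x : X) (y : PiLp 2 Y) : EReal :=
  (∑ i, (((⟪A i x, y i⟫_ℝ : ℝ) : EReal) - conj (f i) (y i))) + g x

/-- `w = (x̂, ŷ)` is a saddle point, i.e. a solution of `min_x max_y saddleFun x y`:
`ŷ` maximizes `saddleFun x̂ ·` and `x̂` minimizes `saddleFun · ŷ`. For convex, proper, lower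
semicontinuous functionals this forces `g(x̂)` and all `fᵢ^*(ŷᵢ)` to be finite, so that no
convention on `∞ - ∞` plays a role. -/
def IsSaddlePoint (A : ∀ i, X →L[ℝ] Y i) (f : ∀ i, Y i → EReal) (g : X → EReal)
    (w : WithLp 2 (X × PiLp 2 Y)) : Prop :=
  (∀ y : PiLp 2 Y, saddleFun A f g w.fst y ≤ saddleFun A f g w.fst w.snd) ∧
  (∀ x : X, saddleFun A f g w.fst w.snd ≤ saddleFun A f g x w.snd)

/-- The state of the algorithm after `k` steps: `x = x^k`, `y = y^k`, `yOld = y^(k-1)`,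
`z = z^k` and `zbar = z̄^k`. -/
structure State (X : Type*) {n : ℕ} (Y : Fin n → Type*) where
  x : X
  y : PiLp 2 Y
  yOld : PiLp 2 Y
  z : X
  zbar : X

/-- The initial state: `x^0` is chosen, `y^0 = y^(-1) = 0`, `z^0 = z̄^0 = 0`. -/
def init (x₀ : X) : State X Y where
  x := x₀
  y := 0
  yOld := 0
  z := 0
  zbar := 0

/-- One step of the algorithm when the index `j` has been selected. -/
def step (A : ∀ i, X →L[ℝ] Y i) (f : ∀ i, Y i → EReal) (g : X → EReal)
    (p σ : Fin n → ℝ) (τ : ℝ) (s : State X Y) (j : Fin n) : State X Y :=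
  let x' : X := prox τ g (s.x - τ • s.zbar)
  let y' : PiLp 2 Y := WithLp.toLp 2 fun i =>
    if i = j then prox (σ i) (conj (f i)) (s.y i + σ i • A i x') else s.y i
  let δ : X := LinearMap.adjoint (A j : X →ₗ[ℝ] Y j) (y' j - s.y j)
  { x := x'
    y := y'
    yOld := s.y
    z := s.z + δ
    zbar := (s.z + δ) + (p j)⁻¹ • δ }

/-- The states generated by the algorithm along a sequence `j` of selected indices. -/
def run (A : ∀ i, X →L[ℝ] Y i) (f : ∀ i, Y i → EReal) (g : X → EReal)
    (p σ : Fin n → ℝ) (τ : ℝ) (x₀ : X) (j : ℕ → Fin n) : ℕ → State X Y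
  | 0 => init x₀
  | k + 1 => step A f g p σ τ (run A f g p σ τ x₀ j k) (j k)

/-- The iterate `w^k = (x^k, y^k)` in the product Hilbert space `X × Y₁ × ⋯ × Yₙ`. -/
def iterate (A : ∀ i, X →L[ℝ] Y i) (f : ∀ i, Y i → EReal) (g : X → EReal)
    (p σ : Fin n → ℝ) (τ : ℝ) (x₀ : X) (j : ℕ → Fin n) (k : ℕ) : WithLp 2 (X × PiLp 2 Y) :=
  WithLp.toLp 2 ((run A f g p σ τ x₀ j k).x, (run A f g p σ τ x₀ j k).y)

/-- The increment `y^k - y^(k-1)` (which is `0` for `k = 0`). -/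
def dualIncrement (A : ∀ i, X →L[ℝ] Y i) (f : ∀ i, Y i → EReal) (g : X → EReal)
    (p σ : Fin n → ℝ) (τ : ℝ) (x₀ : X) (j : ℕ → Fin n) (k : ℕ) : PiLp 2 Y :=
  (run A f g p σ τ x₀ j k).y - (run A f g p σ τ x₀ j k).yOld

/-- The quadratic form `‖y‖²_{Q S⁻¹} = ∑ᵢ ‖yᵢ‖² / (pᵢ σᵢ)`. -/
def dualSq (p σ : Fin n → ℝ) (y : PiLp 2 Y) : ℝ :=
  ∑ i, (p i)⁻¹ * (σ i)⁻¹ * ‖y i‖ ^ 2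

/-- `‖x‖²_{τ⁻¹} - 2 ⟨Q A x, d⟩ + ‖d‖²_{Q S⁻¹} + ‖y‖²_{Q S⁻¹}` at `w = (x, y)`; for
`d = y^k - y^(k-1)` this is `V^k(w)`. -/
def lyapunov (A : ∀ i, X →L[ℝ] Y i) (p σ : Fin n → ℝ) (τ : ℝ) (d : PiLp 2 Y)
    (w : WithLp 2 (X × PiLp 2 Y)) : ℝ :=
  τ⁻¹ * ‖w.fst‖ ^ 2 - 2 * ∑ i, (p i)⁻¹ * ⟪A i w.fst, d i⟫_ℝ + dualSq p σ d + dualSq p σ w.snd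

end Problem

end

end SPDHG

/-!
The saddle points are the solutions of the optimality system `-Aᵀ ŷ ∈ ∂g(x̂)`, `Aᵢ x̂ ∈ ∂fᵢ^*(ŷᵢ)`
(`isSaddlePoint_iff`), and the proximal steps are inclusions of the same kind with an error term that
vanishes together with the steps. Adding up the monotonicity inequalities between the two systems
and averaging over the selected index, one finds that `V^k(w^k - ŵ)` decreases on average by at
least the value of the Lyapunov form at `(x^k - x^(k+1), 0)` (`sum_lyapunov_step_le`). The step size condition
makes the form coercive, because the last dual increment lives in a single block
(`IsCoercivityConstant.le_lyapunov`). After subtracting a small multiple of `‖y^k - y^(k-1)‖²`, the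
decrease also controls the dual steps of all blocks, selected or not
(`sum_reduced_lyapunov_step_le`).

The iterates after `k` steps are functions of finitely many indices, so all measurability questions
are trivial and the supermartingale property is a finite average (`setIntegral_succ_eq`). Martingale
convergence gives, almost surely, that `V^k(w^k - ŵ)` converges and that all steps tend to zero
(`ae_tendsto_lyapunov`).

The norm in the third assertion is the unweighted product norm, whereas `V^k` only controls a
weighted one. The assertion therefore rests on the almost sure convergence of the iterates
themselves. Since the steps vanish and subdifferentials have closed graphs, every cluster point is a
saddle point (`isSaddlePoint_of_tendsto`); since `V^k(w^k - v)` converges for every `v` in a countable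
dense set of saddle points, there is only one cluster point (`ae_exists_tendsto_saddlePoint`). All
four assertions follow from this convergence and from `y^k - y^(k-1) → 0`.
-/

namespace SPDHG

/-! ### Convex functionals, conjugates and proximal points -/

section ConvexAnalysis

variable {E : Type*} [NormedAddCommGroup E] [InnerProductSpace ℝ E]

/-- `s` is a subgradient of `f` at `u`. If `f` is proper, this forces `f u` to be finite. -/
def IsSubgradient (f : E → EReal) (u s : E) : Prop :=
  ∀ y, f u + ((⟪s, y - u⟫_ℝ : ℝ) : EReal) ≤ f y

theorem exists_coe_eq {a : EReal} (h1 : a ≠ ⊥) (h2 : a ≠ ⊤) : ∃ r : ℝ, a = (r : EReal) :=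
  ⟨a.toReal, (EReal.coe_toReal h2 h1).symm⟩

theorem ConvexProperLsc.exists_coe {f : E → EReal} (hf : ConvexProperLsc f) :
    ∃ (v : E) (r : ℝ), f v = (r : EReal) := by
  obtain ⟨v, hv⟩ := hf.exists_ne_top
  obtain ⟨r, hr⟩ := exists_coe_eq (hf.ne_bot v) hv
  exact ⟨v, r, hr⟩

theorem ConvexProperLsc.isClosed_epigraph {f : E → EReal} (hf : ConvexProperLsc f) :
    IsClosed {q : E × ℝ | f q.1 ≤ (q.2 : EReal)} :=
  hf.lsc.isClosed_epigraph.preimage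
    (continuous_fst.prodMk (continuous_coe_real_ereal.comp continuous_snd))

/-- A convex, proper and lower semicontinuous functional has an affine minorant: a hyperplane
that separates a point below the graph from the epigraph is the graph of one. -/
theorem ConvexProperLsc.exists_affine_le [CompleteSpace E] {f : E → EReal}
    (hf : ConvexProperLsc f) :
    ∃ (s : E) (m : ℝ), ∀ v, ((⟪v, s⟫_ℝ - m : ℝ) : EReal) ≤ f v := by
  obtain ⟨v₀, r, hr⟩ := hf.exists_coe
  have hnot : (v₀, r - 1) ∉ {q : E × ℝ | f q.1 ≤ (q.2 : EReal)} := by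
    simp only [Set.mem_ofPred_eq, hr, EReal.coe_le_coe_iff, not_le]
    linarith
  obtain ⟨F, u, hu, hF⟩ := geometric_hahn_banach_point_closed hf.convex hf.isClosed_epigraph hnot
  have hdec : ∀ (v : E) (t : ℝ), F (v, t) = F (v, 0) + t * F (0, 1) := by
    intro v t
    have : ((v, t) : E × ℝ) = (v, 0) + t • ((0, 1) : E × ℝ) := by simp
    rw [this, map_add, map_smul, smul_eq_mul]
  set c := F (0, 1) with hc
  have h0 := hF (v₀, r) (by simp [hr])
  rw [hdec] at hu h0
  have hcpos : 0 < c := by nlinarith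
  set φ : E →L[ℝ] ℝ := F.comp (ContinuousLinearMap.inl ℝ E ℝ) with hφ
  refine ⟨(InnerProductSpace.toDual ℝ E).symm (-(c⁻¹) • φ), -(u / c), fun v => ?_⟩
  by_cases htop : f v = ⊤
  · simp [htop]
  obtain ⟨t, ht⟩ := exists_coe_eq (hf.ne_bot v) htop
  have h1 := hF (v, t) (by simp [ht])
  rw [hdec] at h1
  have h2 : φ v = F (v, 0) := by simp [hφ]
  rw [ht, EReal.coe_le_coe_iff, real_inner_comm, InnerProductSpace.toDual_symm_apply]
  simp only [_root_.smul_apply, smul_eq_mul, h2]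
  have : t - (-c⁻¹ * F (v, 0) - -(u / c)) = (F (v, 0) + t * c - u) / c := by
    field_simp
    ring
  have h3 : 0 ≤ (F (v, 0) + t * c - u) / c := div_nonneg (by linarith) hcpos.le
  linarith

theorem conj_le_coe_iff {f : E → EReal} (hf : ∀ v, f v ≠ ⊥) {y : E} {r : ℝ} :
    conj f y ≤ (r : EReal) ↔ ∀ v, ((⟪v, y⟫_ℝ - r : ℝ) : EReal) ≤ f v := by
  rw [conj, iSup_le_iff]
  refine forall_congr' fun v => ?_
  by_cases htop : f v = ⊤
  · simp [htop]
  obtain ⟨t, ht⟩ := exists_coe_eq (hf v) htop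
  rw [ht, ← EReal.coe_sub, EReal.coe_le_coe_iff, EReal.coe_le_coe_iff]
  constructor <;> intro h <;> linarith

theorem ConvexProperLsc.conj [CompleteSpace E] {f : E → EReal} (hf : ConvexProperLsc f) :
    ConvexProperLsc (conj f) where
  convex := by
    rintro ⟨y, r⟩ h ⟨y', r'⟩ h' a b ha hb hab
    simp only [Set.mem_ofPred_eq, conj_le_coe_iff hf.ne_bot] at h h' ⊢
    intro v
    by_cases htop : f v = ⊤
    · simp [htop]
    obtain ⟨t, ht⟩ := exists_coe_eq (hf.ne_bot v) htop
    have h1 := h v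
    have h2 := h' v
    rw [ht, EReal.coe_le_coe_iff] at h1 h2 ⊢
    simp only [Prod.smul_mk, Prod.mk_add_mk, inner_add_right, inner_smul_right, smul_eq_mul]
    obtain rfl : b = 1 - a := by linarith
    nlinarith [mul_le_mul_of_nonneg_left h1 ha, mul_le_mul_of_nonneg_left h2 hb]
  ne_bot := by
    intro y h
    obtain ⟨v, r, hr⟩ := hf.exists_coe
    have h1 : ((⟪v, y⟫_ℝ : ℝ) : EReal) - f v ≤ SPDHG.conj f y :=
      le_iSup (fun v => ((⟪v, y⟫_ℝ : ℝ) : EReal) - f v) v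
    rw [h, hr, ← EReal.coe_sub, le_bot_iff] at h1
    exact EReal.coe_ne_bot _ h1
  exists_ne_top := by
    obtain ⟨s, m, h⟩ := hf.exists_affine_le
    exact ⟨s, ne_top_of_le_ne_top (EReal.coe_ne_top m) ((conj_le_coe_iff hf.ne_bot).2 h)⟩
  lsc := by
    refine lowerSemicontinuous_iSup fun v => Continuous.lowerSemicontinuous ?_
    induction hv : f v with
    | bot => exact absurd hv (hf.ne_bot v)
    | top => simpa using continuous_const
    | coe r =>
      simp only [← EReal.coe_sub]
      exact continuous_coe_real_ereal.comp (by fun_prop)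

theorem IsSubgradient.exists_coe {f : E → EReal} (hf : ConvexProperLsc f) {u s : E}
    (h : IsSubgradient f u s) : ∃ r : ℝ, f u = (r : EReal) := by
  refine exists_coe_eq (hf.ne_bot u) fun htop => ?_
  obtain ⟨v, r, hr⟩ := hf.exists_coe
  have := h v
  rw [htop, hr, EReal.top_add_coe, top_le_iff] at this
  exact EReal.coe_ne_top _ this

/-- Subdifferentials are monotone. -/
theorem IsSubgradient.inner_sub_nonneg {f : E → EReal} (hf : ConvexProperLsc f) {u s u' s' : E}
    (h : IsSubgradient f u s) (h' : IsSubgradient f u' s') : 0 ≤ ⟪s - s', u - u'⟫_ℝ := by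
  obtain ⟨r, hr⟩ := h.exists_coe hf
  obtain ⟨r', hr'⟩ := h'.exists_coe hf
  have h1 := h u'
  have h2 := h' u
  rw [hr, hr', ← EReal.coe_add, EReal.coe_le_coe_iff] at h1 h2
  have h3 : ⟪s, u' - u⟫_ℝ = -⟪s, u - u'⟫_ℝ := by rw [← inner_neg_right, neg_sub]
  rw [inner_sub_left]
  linarith

/-- Subdifferentials have closed graphs. -/
theorem IsSubgradient.of_tendsto {f : E → EReal} (hf : ConvexProperLsc f) {ι : Type*}
    {l : Filter ι} [l.NeBot] {u s : ι → E} {u₀ s₀ : E} (h : ∀ k, IsSubgradient f (u k) (s k))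
    (hu : Tendsto u l (𝓝 u₀)) (hs : Tendsto s l (𝓝 s₀)) : IsSubgradient f u₀ s₀ := by
  intro y
  by_cases htop : f y = ⊤
  · simp [htop]
  obtain ⟨b, hb⟩ := exists_coe_eq (hf.ne_bot y) htop
  have hlim : Tendsto (fun k => (u k, b - ⟪s k, y - u k⟫_ℝ)) l (𝓝 (u₀, b - ⟪s₀, y - u₀⟫_ℝ)) :=
    hu.prodMk_nhds (tendsto_const_nhds.sub (hs.inner (tendsto_const_nhds.sub hu)))
  have hmem := hf.isClosed_epigraph.mem_of_tendsto hlim (Eventually.of_forall fun k => by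
    obtain ⟨r, hr⟩ := (h k).exists_coe hf
    have := h k y
    rw [hr, hb, ← EReal.coe_add, EReal.coe_le_coe_iff] at this
    simp only [Set.mem_ofPred_eq, hr, EReal.coe_le_coe_iff]
    linarith)
  simp only [Set.mem_ofPred_eq] at hmem
  rw [hb]
  refine (add_le_add_left hmem _).trans ?_
  rw [← EReal.coe_add, sub_add_cancel]

/-- Proximal points exist: an affine minorant makes the minimized functional coercive. -/
theorem ConvexProperLsc.isProx_prox [FiniteDimensional ℝ E] {f : E → EReal}
    (hf : ConvexProperLsc f) {σ : ℝ} (hσ : 0 < σ) (v : E) : IsProx σ f v (prox σ f v) := by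
  refine Classical.epsilon_spec (p := IsProx σ f v) ?_
  have := FiniteDimensional.complete ℝ E
  have := FiniteDimensional.proper_real E
  obtain ⟨s, m, hs⟩ := hf.exists_affine_le
  obtain ⟨y₀, b, hb⟩ := hf.exists_coe
  set F : E → EReal := fun y => ((‖v - y‖ ^ 2 / 2 : ℝ) : EReal) + (σ : EReal) * f y with hF
  have hlsc : LowerSemicontinuous F := by
    have h1 : LowerSemicontinuous fun y => ((‖v - y‖ ^ 2 / 2 : ℝ) : EReal) :=
      (continuous_coe_real_ereal.comp (by fun_prop)).lowerSemicontinuous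
    have h2 : LowerSemicontinuous fun y => (σ : EReal) * f y := by
      refine Continuous.comp_lowerSemicontinuous (g := fun a : EReal => (σ : EReal) * a) ?_ hf.lsc
        fun a b hab => mul_le_mul_of_nonneg_left hab (EReal.coe_nonneg.2 hσ.le)
      refine continuous_iff_continuousAt.2 fun a => ?_
      exact EReal.Tendsto.const_mul tendsto_id (Or.inl (EReal.coe_ne_bot _))
        (Or.inl (EReal.coe_ne_top _))
    exact h1.add' h2 fun y => EReal.continuousAt_add (Or.inl (EReal.coe_ne_top _))
      (Or.inl (EReal.coe_ne_bot _))
  set K : ℝ := ‖v - y₀‖ ^ 2 / 2 + σ * b - σ * (⟪v, s⟫_ℝ - m) with hK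
  set R : ℝ := max ‖v - y₀‖ (2 * (σ * ‖s‖) + 2 + |K|) with hR
  obtain ⟨u, -, hu⟩ := LowerSemicontinuousOn.exists_isMinOn (s := Metric.closedBall v R)
    ⟨y₀, by rw [Metric.mem_closedBall, dist_comm, dist_eq_norm]; exact le_max_left _ _⟩
    (isCompact_closedBall v R) (hlsc.lowerSemicontinuousOn _)
  refine ⟨u, fun y => ?_⟩
  by_cases hy : y ∈ Metric.closedBall v R
  · exact hu hy
  refine (hu (a := y₀) (by
    rw [Metric.mem_closedBall, dist_comm, dist_eq_norm]; exact le_max_left _ _)).trans ?_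
  by_cases htop : f y = ⊤
  · rw [htop, EReal.coe_mul_top_of_pos hσ, EReal.coe_add_top]
    exact le_top
  obtain ⟨t, ht⟩ := exists_coe_eq (hf.ne_bot y) htop
  have h1 := hs y
  rw [ht, EReal.coe_le_coe_iff] at h1
  simp only [hF, hb, ht, ← EReal.coe_mul, ← EReal.coe_add, EReal.coe_le_coe_iff]
  rw [Metric.mem_closedBall, dist_comm, dist_eq_norm, not_le] at hy
  have h2 : 2 * (σ * ‖s‖) + 2 + |K| ≤ ‖v - y‖ := (le_max_right _ _).trans hy.le
  have h3 : ⟪v, s⟫_ℝ - ⟪y, s⟫_ℝ ≤ ‖v - y‖ * ‖s‖ := by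
    rw [← inner_sub_left]
    exact real_inner_le_norm _ _
  set r := ‖v - y‖ with hr
  have h4 : 0 ≤ σ * ‖s‖ := by positivity
  have h5 : K ≤ r ^ 2 / 2 - (σ * ‖s‖) * r := by
    have := le_abs_self K
    have := abs_nonneg K
    nlinarith [mul_nonneg (by linarith : 0 ≤ r - 2) (abs_nonneg K)]
  nlinarith [mul_le_mul_of_nonneg_left h1 hσ.le, mul_le_mul_of_nonneg_left h3 hσ.le]

theorem IsProx.isSubgradient {f : E → EReal} (hf : ConvexProperLsc f) {σ : ℝ} (hσ : 0 < σ)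
    {v u : E} (h : IsProx σ f v u) : IsSubgradient f u (σ⁻¹ • (v - u)) := by
  obtain ⟨a, ha⟩ : ∃ a : ℝ, f u = (a : EReal) := by
    refine exists_coe_eq (hf.ne_bot u) fun htop => ?_
    obtain ⟨y, r, hr⟩ := hf.exists_coe
    have := h y
    rw [htop, hr, EReal.coe_mul_top_of_pos hσ, EReal.coe_add_top, ← EReal.coe_mul,
      ← EReal.coe_add, top_le_iff] at this
    exact EReal.coe_ne_top _ this
  intro y
  by_cases htop : f y = ⊤
  · simp [htop]
  obtain ⟨b, hb⟩ := exists_coe_eq (hf.ne_bot y) htop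
  rw [ha, hb, ← EReal.coe_add, EReal.coe_le_coe_iff, inner_smul_left]
  -- comparison of `u` with the points `u + t (y - u)` of the segment to `y`
  have key : ∀ t : ℝ, 0 < t → t < 1 →
      0 ≤ σ * (b - a) - ⟪v - u, y - u⟫_ℝ + t * (‖y - u‖ ^ 2 / 2) := by
    intro t ht0 ht1
    have hconv : f ((1 - t) • u + t • y) ≤ (((1 - t) * a + t * b : ℝ) : EReal) :=
      hf.convex (x := (u, a)) (by simp [ha]) (y := (y, b)) (by simp [hb])
        (by linarith : (0 : ℝ) ≤ 1 - t) ht0.le (by ring)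
    have h1 := (h ((1 - t) • u + t • y)).trans
      (add_le_add_right (mul_le_mul_of_nonneg_left hconv (EReal.coe_nonneg.2 hσ.le)) _)
    rw [ha, ← EReal.coe_mul, ← EReal.coe_mul, ← EReal.coe_add, ← EReal.coe_add,
      EReal.coe_le_coe_iff] at h1
    have h2 : v - ((1 - t) • u + t • y) = (v - u) - t • (y - u) := by module
    rw [h2, norm_sub_sq_real (v - u), inner_smul_right, norm_smul, mul_pow,
      Real.norm_eq_abs, sq_abs] at h1
    have h3 : 0 ≤ t * (σ * (b - a) - ⟪v - u, y - u⟫_ℝ + t * (‖y - u‖ ^ 2 / 2)) := by linarith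
    exact nonneg_of_mul_nonneg_right h3 ht0
  have hlim : Tendsto (fun t : ℝ => σ * (b - a) - ⟪v - u, y - u⟫_ℝ + t * (‖y - u‖ ^ 2 / 2))
      (𝓝[>] 0) (𝓝 (σ * (b - a) - ⟪v - u, y - u⟫_ℝ + 0 * (‖y - u‖ ^ 2 / 2))) :=
    ((continuous_const.add (continuous_id.mul continuous_const)).tendsto 0).mono_left
      nhdsWithin_le_nhds
  have h0 := ge_of_tendsto hlim (by
    filter_upwards [Ioo_mem_nhdsGT (zero_lt_one' ℝ)] with t ht using key t ht.1 ht.2)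
  have h1 : σ * (a + σ⁻¹ * ⟪v - u, y - u⟫_ℝ) ≤ σ * b := by
    rw [mul_add, mul_inv_cancel_left₀ hσ.ne']
    linarith
  simpa using le_of_mul_le_mul_left h1 hσ

end ConvexAnalysis

/-! ### Saddle points as zeros of the subgradient conditions -/

section SaddlePoint

theorem coe_sum_ereal {ι : Type*} (s : Finset ι) (a : ι → ℝ) :
    ((∑ i ∈ s, a i : ℝ) : EReal) = ∑ i ∈ s, (a i : EReal) := by
  classical
  induction s using Finset.induction_on with
  | empty => simp
  | insert i s hi ih => rw [Finset.sum_insert hi, Finset.sum_insert hi, EReal.coe_add, ih]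

variable {n : ℕ} {X : Type*} [NormedAddCommGroup X] [InnerProductSpace ℝ X]
  {Y : Fin n → Type*} [∀ i, NormedAddCommGroup (Y i)] [∀ i, InnerProductSpace ℝ (Y i)]
  {A : ∀ i, X →L[ℝ] Y i} {f : ∀ i, Y i → EReal} {g : X → EReal}

theorem saddleFun_eq {x : X} {y : PiLp 2 Y} {c : Fin n → ℝ}
    (hc : ∀ i, conj (f i) (y i) = (c i : EReal)) :
    saddleFun A f g x y = ((∑ i, (⟪A i x, y i⟫_ℝ - c i) : ℝ) : EReal) + g x := by
  simp only [saddleFun, hc, coe_sum_ereal, EReal.coe_sub]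

theorem saddleFun_eq_bot {x : X} {y : PiLp 2 Y} {i : Fin n} (hi : conj (f i) (y i) = ⊤) :
    saddleFun A f g x y = ⊥ := by
  rw [saddleFun, ← Finset.add_sum_erase _ _ (Finset.mem_univ i), hi,
    EReal.sub_top, EReal.bot_add, EReal.bot_add]

variable [FiniteDimensional ℝ X] [∀ i, FiniteDimensional ℝ (Y i)]

/-- The adjoint `y ↦ ∑ᵢ Aᵢᵀ yᵢ` of the stacked operator `x ↦ (Aᵢ x)ᵢ`. -/
noncomputable def adjointSum (A : ∀ i, X →L[ℝ] Y i) : PiLp 2 Y →ₗ[ℝ] X :=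
  ∑ i, LinearMap.adjoint (A i : X →ₗ[ℝ] Y i) ∘ₗ (PiLp.projₗ (𝕜 := ℝ) 2 Y i)

theorem adjointSum_apply (A : ∀ i, X →L[ℝ] Y i) (y : PiLp 2 Y) :
    adjointSum A y = ∑ i, LinearMap.adjoint (A i : X →ₗ[ℝ] Y i) (y i) := by
  simp [adjointSum]

theorem inner_adjointSum (A : ∀ i, X →L[ℝ] Y i) (y : PiLp 2 Y) (x : X) :
    ⟪adjointSum A y, x⟫_ℝ = ∑ i, ⟪A i x, y i⟫_ℝ := by
  rw [adjointSum_apply, sum_inner]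
  refine Finset.sum_congr rfl fun i _ => ?_
  rw [LinearMap.adjoint_inner_left, real_inner_comm]
  rfl

/-- Saddle points are the solutions of the optimality system `-Aᵀ ŷ ∈ ∂g(x̂)`,
`Aᵢ x̂ ∈ ∂fᵢ^*(ŷᵢ)`. -/
theorem isSaddlePoint_iff (hf : ∀ i, ConvexProperLsc (f i)) (hg : ConvexProperLsc g)
    {w : WithLp 2 (X × PiLp 2 Y)} :
    IsSaddlePoint A f g w ↔ IsSubgradient g w.fst (-adjointSum A w.snd) ∧
      ∀ i, IsSubgradient (conj (f i)) (w.snd i) (A i w.fst) := by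
  have hf' := fun i => (hf i).conj
  constructor
  · rintro ⟨h1, h2⟩
    have hc : ∀ i, ∃ c : ℝ, conj (f i) (w.snd i) = (c : EReal) := by
      refine fun i => exists_coe_eq ((hf' i).ne_bot _) fun htop => ?_
      choose v r hr using fun i => (hf' i).exists_coe
      have := h1 (WithLp.toLp 2 v)
      rw [saddleFun_eq_bot htop, saddleFun_eq (c := r) (fun i => hr i), le_bot_iff,
        EReal.add_eq_bot_iff] at this
      exact this.elim (EReal.coe_ne_bot _) (hg.ne_bot _)
    choose c hc using hc
    obtain ⟨b, hb⟩ : ∃ b : ℝ, g w.fst = (b : EReal) := by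
      refine exists_coe_eq (hg.ne_bot _) fun htop => ?_
      obtain ⟨v, r, hr⟩ := hg.exists_coe
      have := h2 v
      rw [saddleFun_eq hc, saddleFun_eq hc, htop, hr, EReal.coe_add_top, ← EReal.coe_add,
        top_le_iff] at this
      exact EReal.coe_ne_top _ this
    constructor
    · intro x
      by_cases htop : g x = ⊤
      · simp [htop]
      obtain ⟨r, hr⟩ := exists_coe_eq (hg.ne_bot x) htop
      have := h2 x
      rw [saddleFun_eq hc, saddleFun_eq hc, hb, hr, ← EReal.coe_add, ← EReal.coe_add,
        EReal.coe_le_coe_iff] at this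
      rw [hb, hr, ← EReal.coe_add, EReal.coe_le_coe_iff, inner_neg_left, inner_adjointSum]
      simp only [map_sub, inner_sub_left, Finset.sum_sub_distrib] at this ⊢
      linarith
    · intro i y
      by_cases htop : conj (f i) y = ⊤
      · simp [htop]
      obtain ⟨r, hr⟩ := exists_coe_eq ((hf' i).ne_bot y) htop
      have hc' : ∀ l, conj (f l) ((WithLp.toLp 2 (Function.update (⇑w.snd) i y) : PiLp 2 Y) l)
          = (Function.update c i r l : ℝ) := by
        intro l
        by_cases hl : l = i
        · subst hl
          simpa using hr
        · simpa [hl] using hc l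
      have := h1 (WithLp.toLp 2 (Function.update (⇑w.snd) i y))
      rw [saddleFun_eq hc', saddleFun_eq hc, hb, ← EReal.coe_add, ← EReal.coe_add,
        EReal.coe_le_coe_iff, ← Finset.add_sum_erase _ _ (Finset.mem_univ i),
        ← Finset.add_sum_erase (a := i) _ (fun i => ⟪A i w.fst, w.snd i⟫_ℝ - c i)
          (Finset.mem_univ i)] at this
      have herase : ∑ l ∈ Finset.univ.erase i, (⟪A l w.fst,
          (WithLp.toLp 2 (Function.update (⇑w.snd) i y) : PiLp 2 Y) l⟫_ℝ
            - Function.update c i r l)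
          = ∑ l ∈ Finset.univ.erase i, (⟪A l w.fst, w.snd l⟫_ℝ - c l) := by
        refine Finset.sum_congr rfl fun l hl => ?_
        have := Finset.ne_of_mem_erase hl
        simp [this]
      rw [herase] at this
      simp only [Function.update_self] at this
      rw [hc, hr, ← EReal.coe_add, EReal.coe_le_coe_iff, inner_sub_right]
      linarith
  · rintro ⟨h1, h2⟩
    obtain ⟨b, hb⟩ := h1.exists_coe hg
    choose c hc using fun i => (h2 i).exists_coe (hf' i)
    constructor
    · intro y
      by_cases htop : ∃ i, conj (f i) (y i) = ⊤
      · obtain ⟨i, hi⟩ := htop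
        rw [saddleFun_eq_bot hi]
        exact bot_le
      push Not at htop
      choose r hr using fun i => exists_coe_eq ((hf' i).ne_bot (y i)) (htop i)
      rw [saddleFun_eq hc, saddleFun_eq hr]
      refine add_le_add_left (EReal.coe_le_coe_iff.2 (Finset.sum_le_sum fun i _ => ?_)) _
      have := h2 i (y i)
      rw [hc, hr, ← EReal.coe_add, EReal.coe_le_coe_iff, inner_sub_right] at this
      linarith
    · intro x
      rw [saddleFun_eq hc, saddleFun_eq hc]
      by_cases htop : g x = ⊤
      · rw [htop, EReal.coe_add_top]
        exact le_top
      obtain ⟨r, hr⟩ := exists_coe_eq (hg.ne_bot x) htop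
      have := h1 x
      rw [hb, hr, ← EReal.coe_add, EReal.coe_le_coe_iff, inner_neg_left, inner_adjointSum] at this
      rw [hb, hr, ← EReal.coe_add, ← EReal.coe_add, EReal.coe_le_coe_iff]
      simp only [map_sub, inner_sub_left, Finset.sum_sub_distrib] at this ⊢
      linarith

end SaddlePoint

/-! ### Almost supermartingales driven by independent random indices -/

section RandomIndices

theorem exists_eq_history {ι β : Type*} [Nonempty β] {U : (ℕ → ι) → β} {k : ℕ}
    (hU : DependsOn U (Set.Iio k)) : ∃ h : (Finset.range k → ι) → β,
    ∀ s : ℕ → ι, U s = h fun i => s i := by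
  have hU' : DependsOn U (Finset.range k : Set ℕ) := by simpa using hU
  obtain ⟨h, hh⟩ := dependsOn_iff_exists_comp.1 hU'
  exact ⟨h, fun s => by rw [hh]; rfl⟩

variable {ι Ω : Type*} [Fintype ι] [MeasurableSpace ι] [MeasurableSingletonClass ι]
  [MeasurableSpace Ω] {P : Measure Ω} {j : ℕ → Ω → ι}

/-- The history of a random sequence: the `k`-th σ-algebra is generated by the first `k` indices
`j 0, …, j (k - 1)`. -/
def indexFiltration (hj : ∀ k, Measurable (j k)) : Filtration ℕ (‹MeasurableSpace Ω›) where
  seq k := MeasurableSpace.comap (fun ω (i : Finset.range k) => j i ω) inferInstance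
  mono' k l hkl := by
    rintro s ⟨t, ht, rfl⟩
    refine ⟨(fun (h : Finset.range l → ι) (i : Finset.range k) =>
      h ⟨i, Finset.range_mono hkl i.2⟩) ⁻¹' t, ?_, rfl⟩
    exact (Set.toFinite _).measurableSet
  le' k := (measurable_pi_lambda (fun ω (i : Finset.range k) => j i ω) fun i => hj i).comap_le

theorem integrable_comp_of_dependsOn [IsFiniteMeasure P] (hj : ∀ k, Measurable (j k))
    {U : (ℕ → ι) → ℝ} {k : ℕ} (hU : DependsOn U (Set.Iio k)) :
    Integrable (fun ω => U fun l => j l ω) P := by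
  obtain ⟨h, hh⟩ := exists_eq_history hU
  simp only [hh]
  have hm : Measurable fun ω (i : Finset.range k) => j i ω := measurable_pi_lambda _ fun i => hj i
  exact (Integrable.of_finite (f := h) (μ := P.map _)).comp_measurable hm

/-- The expectation of a functional of the first `k + 1` indices over an event that is determined
by the first `k` ones is computed by averaging over the last index. -/
theorem setIntegral_succ_eq [IsProbabilityMeasure P] {p : ι → ℝ} (hp : ∀ i, 0 ≤ p i)
    (hj : ∀ k, Measurable (j k)) (hindep : iIndepFun j P)
    (hlaw : ∀ k i, P {ω | j k ω = i} = ENNReal.ofReal (p i))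
    {U : (ℕ → ι) → ℝ} {k : ℕ} (hU : DependsOn U (Set.Iio (k + 1))) {s : Set Ω}
    (hs : MeasurableSet[indexFiltration hj k] s) :
    ∫ ω in s, U (fun l => j l ω) ∂P
      = ∫ ω in s, ∑ i, p i * U (Function.update (fun l => j l ω) k i) ∂P := by
  classical
  have hs' := (indexFiltration hj).le k s hs
  obtain ⟨t, ht, rfl⟩ := hs
  set H : Ω → Finset.range k → ι := fun ω i => j i ω with hH
  have hHm : Measurable H := measurable_pi_lambda _ fun i => hj i
  have hdep : ∀ i, DependsOn (fun s => U (Function.update s k i)) (Set.Iio k) := by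
    intro i s s' hss
    refine hU fun l hl => ?_
    rcases eq_or_ne l k with rfl | hlk
    · simp
    · have : l < k := lt_of_le_of_ne (Nat.lt_succ_iff.1 hl) hlk
      simp [hlk, hss l this]
  choose h hh using fun i => exists_eq_history (hdep i)
  have hint : ∀ i, Integrable (fun ω => U (Function.update (fun l => j l ω) k i)) P :=
    fun i => integrable_comp_of_dependsOn hj (hdep i)
  -- the event and the functional with the last index frozen at `i`
  set G : ι → (Finset.range k → ι) → ℝ := fun i x => t.indicator (h i) x with hG
  set I : ι → ι → ℝ := fun i x => if x = i then 1 else 0 with hI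
  have hindep' : ∀ i, IndepFun (fun ω => G i (H ω)) (fun ω => I i (j k ω)) P := by
    intro i
    have h1 := hindep.indepFun_finset (Finset.range k) {k} (by simp) hj
    exact h1.comp (φ := G i) (ψ := fun x : ({k} : Finset ℕ) → ι => I i (x ⟨k, by simp⟩))
      (measurable_of_finite _) (measurable_of_finite _)
  have hprob : ∀ i, ∫ ω, I i (j k ω) ∂P = p i := by
    intro i
    have h1 : (fun ω => I i (j k ω)) = ({ω | j k ω = i} : Set Ω).indicator 1 := by
      ext ω
      simp [hI, Set.indicator_apply]
    have h2 : MeasurableSet {ω | j k ω = i} := hj k (measurableSet_singleton i)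
    rw [h1, integral_indicator_one h2, measureReal_def, hlaw, ENNReal.toReal_ofReal (hp i)]
  have hGH : ∀ i ω, G i (H ω)
      = (H ⁻¹' t).indicator (fun ω => U (Function.update (fun l => j l ω) k i)) ω := by
    intro i ω
    simp only [hG, Set.indicator_apply, Set.mem_preimage, hh]
    rfl
  have hGint : ∀ i, Integrable (fun ω => G i (H ω)) P := fun i =>
    (Integrable.of_finite (f := G i) (μ := P.map H)).comp_measurable hHm
  have hIm : ∀ i, Measurable fun ω => I i (j k ω) := fun i =>
    (measurable_of_finite (I i)).comp (hj k)
  have hsplit : (H ⁻¹' t).indicator (fun ω => U fun l => j l ω)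
      = fun ω => ∑ i, G i (H ω) * I i (j k ω) := by
    ext ω
    simp only [hI, mul_ite, mul_one, mul_zero, Finset.sum_ite_eq, Finset.mem_univ, if_true, hGH]
    by_cases hω : ω ∈ H ⁻¹' t
    · simp only [Set.indicator_of_mem hω]
      congr 1
      exact (Function.update_eq_self k (fun l => j l ω)).symm
    · simp only [Set.indicator_of_notMem hω]
  rw [← integral_indicator hs', hsplit, integral_finsetSum, integral_finsetSum]
  · refine Finset.sum_congr rfl fun i _ => ?_
    rw [(hindep' i).integral_fun_mul_eq_mul_integral (hGint i).aestronglyMeasurable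
      (hIm i).aestronglyMeasurable, hprob, integral_const_mul, mul_comm,
      ← integral_indicator hs']
    simp only [hGH]
  · exact fun i _ => ((hint i).const_mul _).integrableOn
  · intro i _
    refine (hGint i).mul_bdd (c := 1) (hIm i).aestronglyMeasurable (ae_of_all _ fun ω => ?_)
    simp only [hI]
    split_ifs <;> simp

/-- A nonnegative functional of the first `k` indices whose average over the next index does not
increase is a nonnegative supermartingale, hence converges almost surely. -/
theorem ae_exists_tendsto_of_average_le [IsProbabilityMeasure P] {p : ι → ℝ} (hp : ∀ i, 0 ≤ p i)
    (hj : ∀ k, Measurable (j k)) (hindep : iIndepFun j P)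
    (hlaw : ∀ k i, P {ω | j k ω = i} = ENNReal.ofReal (p i))
    {U : ℕ → (ℕ → ι) → ℝ} (hU : ∀ k, DependsOn (U k) (Set.Iio k)) (hnonneg : ∀ k s, 0 ≤ U k s)
    (hle : ∀ k s, ∑ i, p i * U (k + 1) (Function.update s k i) ≤ U k s) :
    ∀ᵐ ω ∂P, ∃ a : ℝ, Tendsto (fun k => U k fun l => j l ω) atTop (𝓝 a) := by
  have hint : ∀ k, Integrable (fun ω => U k fun l => j l ω) P :=
    fun k => integrable_comp_of_dependsOn hj (hU k)
  have hadapt : StronglyAdapted (indexFiltration hj) fun k ω => U k fun l => j l ω := by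
    intro k
    obtain ⟨h, hh⟩ := exists_eq_history (hU k)
    simp only [hh]
    refine Measurable.stronglyMeasurable ?_
    exact (measurable_of_finite h).comp (comap_measurable _)
  have hsuper : Supermartingale (fun k ω => U k fun l => j l ω) (indexFiltration hj) P := by
    refine supermartingale_of_setIntegral_succ_le hadapt hint fun k s hs => ?_
    rw [setIntegral_succ_eq hp hj hindep hlaw (hU (k + 1)) hs]
    refine setIntegral_mono ?_ (hint k).integrableOn fun ω => hle k _
    refine integrable_finsetSum _ fun i _ => (Integrable.const_mul ?_ _)
    refine (integrable_comp_of_dependsOn (k := k) (U := fun s => U (k + 1) (Function.update s k i))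
      hj fun s s' hss => hU (k + 1) fun l hl => ?_).integrableOn
    rcases eq_or_ne l k with rfl | hlk
    · simp
    · simp [hlk, hss l (lt_of_le_of_ne (Nat.lt_succ_iff.1 hl) hlk)]
  have hL1 : ∀ k, eLpNorm ((-fun k ω => U k fun l => j l ω) k) 1 P
      ≤ ((∫ ω, U 0 (fun l => j l ω) ∂P).toNNReal : ENNReal) := by
    intro k
    have h1 := hsuper.setIntegral_le (Nat.zero_le k) (s := Set.univ) MeasurableSet.univ
    rw [setIntegral_univ, setIntegral_univ] at h1
    rw [Pi.neg_apply, eLpNorm_neg, eLpNorm_one_eq_lintegral_enorm]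
    have h2 : ∫⁻ ω, ‖U k fun l => j l ω‖ₑ ∂P = ENNReal.ofReal (∫ ω, U k (fun l => j l ω) ∂P) := by
      rw [ofReal_integral_eq_lintegral_ofReal (hint k) (ae_of_all _ fun ω => hnonneg k _)]
      exact lintegral_congr fun ω => Real.enorm_of_nonneg (hnonneg k _)
    rw [h2]
    exact ENNReal.ofReal_le_ofReal h1
  filter_upwards [hsuper.neg.exists_ae_tendsto_of_bdd hL1] with ω hω
  obtain ⟨a, ha⟩ := hω
  exact ⟨-a, by simpa using ha.neg⟩

/-- An almost supermartingale theorem of Robbins–Siegmund type: if averaging over the next index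
decreases the nonnegative functional `U k` by at least `D k ≥ 0`, then almost surely `U k` converges
and the decreases are summable. -/
theorem ae_tendsto_and_summable [IsProbabilityMeasure P] {p : ι → ℝ} (hp : ∀ i, 0 ≤ p i)
    (hsum : ∑ i, p i = 1) (hj : ∀ k, Measurable (j k)) (hindep : iIndepFun j P)
    (hlaw : ∀ k i, P {ω | j k ω = i} = ENNReal.ofReal (p i))
    {U D : ℕ → (ℕ → ι) → ℝ} (hU : ∀ k, DependsOn (U k) (Set.Iio k))
    (hD : ∀ k, DependsOn (D k) (Set.Iio k)) (hU0 : ∀ k s, 0 ≤ U k s) (hD0 : ∀ k s, 0 ≤ D k s)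
    (hle : ∀ k s, ∑ i, p i * U (k + 1) (Function.update s k i) ≤ U k s - D k s) :
    ∀ᵐ ω ∂P, (∃ a : ℝ, Tendsto (fun k => U k fun l => j l ω) atTop (𝓝 a)) ∧
      Summable fun k => D k fun l => j l ω := by
  -- adding the accumulated decreases to `U` keeps the supermartingale property
  have hM := ae_exists_tendsto_of_average_le hp hj hindep hlaw
    (U := fun k s => U k s + ∑ l ∈ Finset.range k, D l s)
    (fun k s s' hss => by
      simp only [hU k hss]
      congr 1
      refine Finset.sum_congr rfl fun l hl => hD l fun m hm => hss m ?_
      exact lt_trans hm (Finset.mem_range.1 hl))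
    (fun k s => add_nonneg (hU0 k s) (Finset.sum_nonneg fun l _ => hD0 l s))
    (fun k s => by
      have h1 : ∀ i, ∑ l ∈ Finset.range (k + 1), D l (Function.update s k i)
          = ∑ l ∈ Finset.range (k + 1), D l s := fun i =>
        Finset.sum_congr rfl fun l hl => hD l fun m hm =>
          Function.update_of_ne (lt_of_lt_of_le hm (Nat.lt_succ_iff.1 (Finset.mem_range.1 hl))).ne
            _ _
      simp only [h1, mul_add, Finset.sum_add_distrib, ← Finset.sum_mul, hsum, one_mul]
      rw [Finset.sum_range_succ]
      linarith [hle k s])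
  filter_upwards [hM] with ω hω
  obtain ⟨a, ha⟩ := hω
  have hs : Summable fun k => D k fun l => j l ω := by
    obtain ⟨B, hB⟩ := ha.bddAbove_range
    refine summable_of_sum_range_le (c := B) (fun k => hD0 k _) fun k => ?_
    have h1 : U k (fun l => j l ω) + ∑ l ∈ Finset.range k, D l (fun l => j l ω) ≤ B :=
      hB ⟨k, rfl⟩
    linarith [hU0 k fun l => j l ω]
  refine ⟨⟨a - ∑' k, D k fun l => j l ω, ?_⟩, hs⟩
  simpa using ha.sub hs.hasSum.tendsto_sum_nat

end RandomIndices

/-! ### Coercivity of the Lyapunov functional -/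

section Coercivity

/-- A quadratic form `a s² - 2 m s t + b t²` with `m² < a b` is positive definite. -/
theorem exists_pos_mul_sq_le {a b m : ℝ} (ha : 0 < a) (hb : 0 < b) (h : m ^ 2 < a * b) :
    ∃ c > 0, ∀ s t : ℝ, c * s ^ 2 + c * t ^ 2 ≤ a * s ^ 2 - 2 * (m * s * t) + b * t ^ 2 := by
  have hab : 0 < a + b := by linarith
  set c := (a * b - m ^ 2) / (a + b) with hc
  have hcm : c * (a + b) = a * b - m ^ 2 := div_mul_cancel₀ _ hab.ne'
  have hca : 0 < a - c := by nlinarith [sq_nonneg m, sq_nonneg a]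
  have hdet : m ^ 2 ≤ (a - c) * (b - c) := by nlinarith [sq_nonneg c]
  refine ⟨c, div_pos (by linarith) hab, fun s t => ?_⟩
  have h1 : 0 ≤ (a - c) * ((a - c) * s ^ 2 - 2 * (m * s * t) + (b - c) * t ^ 2) := by
    nlinarith [sq_nonneg ((a - c) * s - m * t), mul_nonneg (sub_nonneg.2 hdet) (sq_nonneg t)]
  linarith [nonneg_of_mul_nonneg_right h1 hca]

variable {n : ℕ} {X : Type*} [NormedAddCommGroup X] [InnerProductSpace ℝ X]
  {Y : Fin n → Type*} [∀ i, NormedAddCommGroup (Y i)] [∀ i, InnerProductSpace ℝ (Y i)]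
  {A : ∀ i, X →L[ℝ] Y i} {p σ : Fin n → ℝ} {τ : ℝ}

/-- `c > 0` is a lower bound for the primal-dual quadratic form of each single block. -/
structure IsCoercivityConstant (A : ∀ i, X →L[ℝ] Y i) (p σ : Fin n → ℝ) (τ c : ℝ) : Prop where
  pos : 0 < c
  le_primal : c ≤ τ⁻¹
  le_dual : ∀ i, c ≤ (p i)⁻¹ * (σ i)⁻¹
  le_block : ∀ i u e, c * ‖u‖ ^ 2 + c * ‖e‖ ^ 2
    ≤ τ⁻¹ * ‖u‖ ^ 2 - 2 * ((p i)⁻¹ * ⟪A i u, e⟫_ℝ) + (p i)⁻¹ * (σ i)⁻¹ * ‖e‖ ^ 2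

theorem exists_isCoercivityConstant (hp : ∀ i, 0 < p i) (hσ : ∀ i, 0 < σ i) (hτ : 0 < τ)
    (hstep : ∀ i, τ * σ i * ‖A i‖ ^ 2 < p i) : ∃ c, IsCoercivityConstant A p σ τ c := by
  have hblock : ∀ i, ∃ c > 0, ∀ u e, c * ‖u‖ ^ 2 + c * ‖e‖ ^ 2
      ≤ τ⁻¹ * ‖u‖ ^ 2 - 2 * ((p i)⁻¹ * ⟪A i u, e⟫_ℝ) + (p i)⁻¹ * (σ i)⁻¹ * ‖e‖ ^ 2 := by
    intro i
    have hpi := hp i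
    have hσi := hσ i
    have h1 : ((p i)⁻¹ * ‖A i‖) ^ 2 < τ⁻¹ * ((p i)⁻¹ * (σ i)⁻¹) := by
      have h2 : ((p i)⁻¹ * ‖A i‖) ^ 2
          = (τ⁻¹ * ((p i)⁻¹ * (σ i)⁻¹)) * ((p i)⁻¹ * (τ * σ i * ‖A i‖ ^ 2)) := by
        field_simp
      have h3 : (p i)⁻¹ * (τ * σ i * ‖A i‖ ^ 2) < 1 := by
        rw [inv_mul_lt_one₀ hpi]
        exact hstep i
      rw [h2]
      exact mul_lt_of_lt_one_right (by positivity) h3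
    obtain ⟨c, hc, hle⟩ := exists_pos_mul_sq_le (by positivity) (by positivity) h1
    refine ⟨c, hc, fun u e => (hle ‖u‖ ‖e‖).trans ?_⟩
    have h2 : (p i)⁻¹ * ⟪A i u, e⟫_ℝ ≤ (p i)⁻¹ * ‖A i‖ * ‖u‖ * ‖e‖ := by
      rw [mul_assoc, mul_assoc, ← mul_assoc ‖A i‖]
      refine mul_le_mul_of_nonneg_left ?_ (by positivity)
      exact (real_inner_le_norm _ _).trans
        (mul_le_mul_of_nonneg_right ((A i).le_opNorm u) (norm_nonneg e))
    linarith
  choose c hc hle using hblock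
  have h1 : ∀ᶠ b in 𝓝[>] (0 : ℝ), ∀ i, b < c i ∧ b < (p i)⁻¹ * (σ i)⁻¹ :=
    eventually_all.2 fun i => by
      have hdual : 0 < (p i)⁻¹ * (σ i)⁻¹ := mul_pos (inv_pos.2 (hp i)) (inv_pos.2 (hσ i))
      filter_upwards [Ioo_mem_nhdsGT (hc i), Ioo_mem_nhdsGT hdual] with b hb hb'
      exact ⟨hb.2, hb'.2⟩
  obtain ⟨b, hb, hb'⟩ := (h1.and (Ioo_mem_nhdsGT (inv_pos.2 hτ))).exists
  refine ⟨b, hb'.1, hb'.2.le, fun i => (hb i).2.le, fun i u e => le_trans ?_ (hle i u e)⟩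
  exact add_le_add (mul_le_mul_of_nonneg_right (hb i).1.le (by positivity))
    (mul_le_mul_of_nonneg_right (hb i).1.le (by positivity))

/-- The Lyapunov functional is coercive as long as the dual increment `d` lives in a single block.
-/
theorem IsCoercivityConstant.le_lyapunov {c : ℝ} (hc : IsCoercivityConstant A p σ τ c)
    {d : PiLp 2 Y} (hd : {i | d i ≠ 0}.Subsingleton) (w : WithLp 2 (X × PiLp 2 Y)) :
    c * ‖w‖ ^ 2 + c * ‖d‖ ^ 2 ≤ lyapunov A p σ τ d w := by
  have h1 : c * ‖w.snd‖ ^ 2 ≤ dualSq p σ w.snd := by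
    rw [dualSq, PiLp.norm_sq_eq_of_L2, Finset.mul_sum]
    exact Finset.sum_le_sum fun i _ => mul_le_mul_of_nonneg_right (hc.le_dual i) (by positivity)
  have h2 : c * ‖w.fst‖ ^ 2 + c * ‖d‖ ^ 2
      ≤ τ⁻¹ * ‖w.fst‖ ^ 2 - 2 * ∑ i, (p i)⁻¹ * ⟪A i w.fst, d i⟫_ℝ + dualSq p σ d := by
    rw [dualSq, PiLp.norm_sq_eq_of_L2]
    by_cases h0 : ∃ i, d i ≠ 0
    · obtain ⟨i, hi⟩ := h0
      have hother : ∀ l ≠ i, d l = 0 := fun l hl => by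
        by_contra h
        exact hl (hd h hi)
      rw [Finset.sum_eq_single i (fun l _ hl => by simp [hother l hl]) (by simp),
        Finset.sum_eq_single i (fun l _ hl => by simp [hother l hl]) (by simp),
        Finset.sum_eq_single i (fun l _ hl => by simp [hother l hl]) (by simp)]
      exact hc.le_block i _ _
    · push Not at h0
      simpa [h0] using mul_le_mul_of_nonneg_right hc.le_primal (sq_nonneg ‖w.fst‖)
  rw [lyapunov, WithLp.prod_norm_sq_eq_of_L2]
  linarith

theorem continuous_lyapunov (A : ∀ i, X →L[ℝ] Y i) (p σ : Fin n → ℝ) (τ : ℝ) :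
    Continuous fun q : PiLp 2 Y × WithLp 2 (X × PiLp 2 Y) => lyapunov A p σ τ q.1 q.2 := by
  unfold lyapunov dualSq
  have h1 : Continuous fun q : PiLp 2 Y × WithLp 2 (X × PiLp 2 Y) => q.2.fst :=
    (WithLp.prod_continuous_ofLp 2 X (PiLp 2 Y)).fst.comp continuous_snd
  have h2 : Continuous fun q : PiLp 2 Y × WithLp 2 (X × PiLp 2 Y) => q.2.snd :=
    (WithLp.prod_continuous_ofLp 2 X (PiLp 2 Y)).snd.comp continuous_snd
  have h3 : ∀ i, Continuous fun q : PiLp 2 Y × WithLp 2 (X × PiLp 2 Y) => q.2.snd i :=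
    fun i => (PiLp.continuous_apply 2 Y i).comp h2
  fun_prop

theorem tendsto_lyapunov {ι : Type*} {l : Filter ι} {d : ι → PiLp 2 Y} {d₀ : PiLp 2 Y}
    {w : ι → WithLp 2 (X × PiLp 2 Y)} {w₀ : WithLp 2 (X × PiLp 2 Y)} (hd : Tendsto d l (𝓝 d₀))
    (hw : Tendsto w l (𝓝 w₀)) :
    Tendsto (fun k => lyapunov A p σ τ (d k) (w k)) l (𝓝 (lyapunov A p σ τ d₀ w₀)) := by
  have h1 := (continuous_lyapunov A p σ τ).tendsto (d₀, w₀)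
  have h2 := h1.comp (hd.prodMk_nhds hw)
  exact h2

end Coercivity

/-! ### One step of the algorithm -/

section Algorithm

variable {n : ℕ} {X : Type*} [NormedAddCommGroup X] [InnerProductSpace ℝ X]
  [FiniteDimensional ℝ X] {Y : Fin n → Type*} [∀ i, NormedAddCommGroup (Y i)]
  [∀ i, InnerProductSpace ℝ (Y i)] [∀ i, FiniteDimensional ℝ (Y i)]
  {A : ∀ i, X →L[ℝ] Y i} {f : ∀ i, Y i → EReal} {g : X → EReal} {p σ : Fin n → ℝ} {τ : ℝ}

variable (A f g σ τ) in
/-- The primal iterate `x^(k+1)`; it does not depend on the index selected at step `k`. -/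
noncomputable def nextPrimal (s : State X Y) : X :=
  prox τ g (s.x - τ • s.zbar)

variable (A f g σ τ) in
/-- The dual point whose `i`-th block is the value of `y_i^(k+1)` if the index `i` is selected. -/
noncomputable def trialDual (s : State X Y) : PiLp 2 Y :=
  WithLp.toLp 2 fun i => prox (σ i) (conj (f i)) (s.y i + σ i • A i (nextPrimal g τ s))

/-- The pair `(x^k, y^k)` of a state. -/
def State.pair (s : State X Y) : WithLp 2 (X × PiLp 2 Y) := WithLp.toLp 2 (s.x, s.y)

/-- The relations between the variables of a state that the algorithm preserves: `z^k = Aᵀ y^k`,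
`z̄^k = Aᵀ (y^k + p⁻¹ (y^k - y^(k-1)))`, and the last dual increment lives in a single block. -/
structure State.IsConsistent (A : ∀ i, X →L[ℝ] Y i) (p : Fin n → ℝ) (s : State X Y) : Prop where
  z_eq : s.z = adjointSum A s.y
  zbar_eq : s.zbar = adjointSum A s.y
    + adjointSum A (WithLp.toLp 2 fun i => (p i)⁻¹ • (s.y - s.yOld) i)
  subsingleton : {i | (s.y - s.yOld) i ≠ 0}.Subsingleton

theorem step_yOld (s : State X Y) (j : Fin n) : (step A f g p σ τ s j).yOld = s.y := rfl

theorem step_y (s : State X Y) (i j : Fin n) :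
    (step A f g p σ τ s j).y i = if i = j then trialDual A f g σ τ s i else s.y i := rfl

theorem step_increment (s : State X Y) (i j : Fin n) :
    ((step A f g p σ τ s j).y - (step A f g p σ τ s j).yOld) i
      = if i = j then (trialDual A f g σ τ s - s.y) i else 0 := by
  rw [step_yOld, PiLp.sub_apply, step_y]
  split_ifs <;> simp

theorem isConsistent_init (x₀ : X) : (init x₀ : State X Y).IsConsistent A p where
  z_eq := by simp [init]
  zbar_eq := by
    have : (WithLp.toLp 2 fun i => (p i)⁻¹ • ((0 : PiLp 2 Y) - 0) i : PiLp 2 Y) = 0 := by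
      ext i
      simp
    simp only [init, this, map_zero, add_zero]
  subsingleton := by simp [init]

theorem State.IsConsistent.step {s : State X Y} (hs : s.IsConsistent A p) (j : Fin n) :
    (step A f g p σ τ s j).IsConsistent A p := by
  have hδ : ∀ c : Fin n → ℝ, adjointSum A (WithLp.toLp 2 fun i =>
        c i • ((SPDHG.step A f g p σ τ s j).y - (SPDHG.step A f g p σ τ s j).yOld) i)
      = c j • LinearMap.adjoint (A j : X →ₗ[ℝ] Y j) ((SPDHG.step A f g p σ τ s j).y j - s.y j) := by
    intro c
    rw [adjointSum_apply, Finset.sum_eq_single j]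
    · simp [step_yOld]
    · intro i _ hij
      simp only [step_increment, if_neg hij, smul_zero, map_zero]
    · simp
  have hz : (SPDHG.step A f g p σ τ s j).z = adjointSum A (SPDHG.step A f g p σ τ s j).y := by
    have h1 := hδ fun _ => 1
    have h2 : (WithLp.toLp 2 fun i => (1 : ℝ) •
        ((SPDHG.step A f g p σ τ s j).y - (SPDHG.step A f g p σ τ s j).yOld) i : PiLp 2 Y)
        = (SPDHG.step A f g p σ τ s j).y - s.y := by
      ext i
      simp [step_yOld]
    rw [h2, map_sub, one_smul] at h1
    have h3 : (SPDHG.step A f g p σ τ s j).z = s.z + LinearMap.adjoint (A j : X →ₗ[ℝ] Y j)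
        ((SPDHG.step A f g p σ τ s j).y j - s.y j) := rfl
    rw [h3, ← h1, hs.z_eq]
    abel
  refine ⟨hz, ?_, fun i hi l hl => ?_⟩
  · rw [hδ fun i => (p i)⁻¹, ← hz]
    rfl
  · simp only [Set.mem_ofPred_eq, step_increment, ne_eq, ite_eq_right_iff, Classical.not_imp]
      at hi hl
    rw [hi.1, hl.1]

omit [∀ i, NormedAddCommGroup (Y i)] [∀ i, InnerProductSpace ℝ (Y i)]
  [∀ i, FiniteDimensional ℝ (Y i)] in
theorem isSubgradient_nextPrimal (hg : ConvexProperLsc g) (hτ : 0 < τ) (s : State X Y) :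
    IsSubgradient g (nextPrimal g τ s) (τ⁻¹ • (s.x - nextPrimal g τ s) - s.zbar) := by
  have h : IsSubgradient g (nextPrimal g τ s)
      (τ⁻¹ • (s.x - τ • s.zbar - nextPrimal g τ s)) :=
    (hg.isProx_prox hτ (s.x - τ • s.zbar)).isSubgradient hg hτ
  rwa [sub_right_comm, smul_sub _ _ (τ • _), inv_smul_smul₀ hτ.ne'] at h

omit [FiniteDimensional ℝ X] in
theorem isSubgradient_trialDual (hf : ∀ i, ConvexProperLsc (f i)) (hσ : ∀ i, 0 < σ i)
    (s : State X Y) (i : Fin n) :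
    IsSubgradient (conj (f i)) (trialDual A f g σ τ s i)
      ((σ i)⁻¹ • (s.y - trialDual A f g σ τ s) i + A i (nextPrimal g τ s)) := by
  have h : IsSubgradient (conj (f i)) (trialDual A f g σ τ s i)
      ((σ i)⁻¹ • (s.y i + σ i • A i (nextPrimal g τ s) - trialDual A f g σ τ s i)) :=
    ((hf i).conj.isProx_prox (hσ i)
      (s.y i + σ i • A i (nextPrimal g τ s))).isSubgradient (hf i).conj (hσ i)
  rwa [add_sub_right_comm, smul_add, inv_smul_smul₀ (hσ i).ne'] at h

theorem inner_smul_sub_add {E : Type*} [NormedAddCommGroup E] [InnerProductSpace ℝ E] (c : ℝ)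
    (u v w : E) : 2 * ⟪c • (u - v), v - w⟫_ℝ
      = c * (‖u - w‖ ^ 2 - ‖v - w‖ ^ 2 - ‖u - v‖ ^ 2) := by
  have h : u - w = (u - v) + (v - w) := by abel
  rw [h, norm_add_sq_real, inner_smul_left]
  simp only [conj_trivial]
  ring

/-- The average of a sum over all blocks in which only the selected block has changed. -/
theorem sum_mul_sum_ite (hp : ∀ i, 0 < p i) (hsum : ∑ i, p i = 1) (a b : Fin n → ℝ) :
    ∑ j, p j * ∑ i, (p i)⁻¹ * (if i = j then a i else b i)
      = ∑ i, (a i - b i) + ∑ i, (p i)⁻¹ * b i := by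
  have h1 : ∀ j, ∑ i, (p i)⁻¹ * (if i = j then a i else b i)
      = (p j)⁻¹ * (a j - b j) + ∑ i, (p i)⁻¹ * b i := by
    intro j
    have h2 : ∀ i, (p i)⁻¹ * (if i = j then a i else b i)
        = (if i = j then (p i)⁻¹ * (a i - b i) else 0) + (p i)⁻¹ * b i := by
      intro i
      split_ifs <;> ring
    simp only [h2, Finset.sum_add_distrib, Finset.sum_ite_eq', Finset.mem_univ, if_true]
  simp only [h1, mul_add, Finset.sum_add_distrib, ← Finset.sum_mul, hsum, one_mul]
  congr 1
  exact Finset.sum_congr rfl fun i _ => mul_inv_cancel_left₀ (hp i).ne' _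

/-- The Lyapunov functional decreases on average over the selected index. The two monotonicity
inequalities, between the proximal points and the saddle point, are added up; the coupling terms
that remain are those of the Lyapunov functional because `z̄^k` is extrapolated by `p⁻¹`. -/
theorem sum_lyapunov_step_le (hf : ∀ i, ConvexProperLsc (f i)) (hg : ConvexProperLsc g)
    (hp : ∀ i, 0 < p i) (hsum : ∑ i, p i = 1) (hσ : ∀ i, 0 < σ i) (hτ : 0 < τ)
    {w : WithLp 2 (X × PiLp 2 Y)} (hw : IsSaddlePoint A f g w) {s : State X Y}
    (hs : s.IsConsistent A p) :
    ∑ j, p j * lyapunov A p σ τ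
        ((step A f g p σ τ s j).y - (step A f g p σ τ s j).yOld)
        ((step A f g p σ τ s j).pair - w)
      ≤ lyapunov A p σ τ (s.y - s.yOld) (s.pair - w)
        - lyapunov A p σ τ (s.y - s.yOld) (WithLp.toLp 2 (s.x - nextPrimal g τ s, 0)) := by
  obtain ⟨hw1, hw2⟩ := (isSaddlePoint_iff hf hg).1 hw
  set x' := nextPrimal g τ s with hx'
  set t := trialDual A f g σ τ s with ht
  set d := s.y - s.yOld with hd
  -- monotonicity of the subdifferential of `g`
  have hprimal : 2 * ∑ i, ⟪A i (x' - w.fst), (s.y - w.snd) i⟫_ℝ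
      + 2 * ∑ i, (p i)⁻¹ * ⟪A i (x' - w.fst), d i⟫_ℝ
      ≤ τ⁻¹ * (‖s.x - w.fst‖ ^ 2 - ‖x' - w.fst‖ ^ 2 - ‖s.x - x'‖ ^ 2) := by
    have h1 := (isSubgradient_nextPrimal hg hτ s).inner_sub_nonneg hg hw1
    rw [← hx', hs.zbar_eq] at h1
    have h2 : τ⁻¹ • (s.x - x') - (adjointSum A s.y
        + adjointSum A (WithLp.toLp 2 fun i => (p i)⁻¹ • d i)) - -adjointSum A w.snd
        = τ⁻¹ • (s.x - x') - (adjointSum A (s.y - w.snd)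
          + adjointSum A (WithLp.toLp 2 fun i => (p i)⁻¹ • d i)) := by
      rw [map_sub]
      abel
    rw [h2, inner_sub_left, inner_add_left, inner_adjointSum, inner_adjointSum] at h1
    simp only [inner_smul_right] at h1
    rw [← inner_smul_sub_add]
    linarith
  -- monotonicity of the subdifferentials of the conjugates
  have hdual : ∀ i, (-2 * ⟪A i (x' - w.fst), (t - s.y) i⟫_ℝ + (σ i)⁻¹ * ‖(t - s.y) i‖ ^ 2
        + (σ i)⁻¹ * ‖(t - w.snd) i‖ ^ 2) - (σ i)⁻¹ * ‖(s.y - w.snd) i‖ ^ 2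
      ≤ 2 * ⟪A i (x' - w.fst), (s.y - w.snd) i⟫_ℝ := by
    intro i
    have h1 := (isSubgradient_trialDual (A := A) (g := g) (τ := τ) hf hσ s i).inner_sub_nonneg
      (hf i).conj (hw2 i)
    rw [← hx', ← ht, add_sub_assoc, ← map_sub, inner_add_left] at h1
    have h2 := inner_smul_sub_add (σ i)⁻¹ (s.y i) (t i) (w.snd i)
    simp only [PiLp.sub_apply] at h1 ⊢
    rw [norm_sub_rev (t i) (s.y i)]
    have h3 : ⟪A i (x' - w.fst), t i - w.snd i⟫_ℝ = ⟪A i (x' - w.fst), t i - s.y i⟫_ℝ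
        + ⟪A i (x' - w.fst), s.y i - w.snd i⟫_ℝ := by
      rw [← inner_add_right]
      congr 1
      abel
    linarith
  have hstep : ∀ j, lyapunov A p σ τ
        ((step A f g p σ τ s j).y - (step A f g p σ τ s j).yOld) ((step A f g p σ τ s j).pair - w)
      = τ⁻¹ * ‖x' - w.fst‖ ^ 2 + ∑ i, (p i)⁻¹ * (if i = j then
          -2 * ⟪A i (x' - w.fst), (t - s.y) i⟫_ℝ + (σ i)⁻¹ * ‖(t - s.y) i‖ ^ 2
            + (σ i)⁻¹ * ‖(t - w.snd) i‖ ^ 2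
          else (σ i)⁻¹ * ‖(s.y - w.snd) i‖ ^ 2) := by
    intro j
    have h1 : ((step A f g p σ τ s j).pair - w).fst = x' - w.fst := rfl
    have h2 : ∀ i, ((step A f g p σ τ s j).pair - w).snd i
        = if i = j then (t - w.snd) i else (s.y - w.snd) i := by
      intro i
      have : ((step A f g p σ τ s j).pair - w).snd i = (step A f g p σ τ s j).y i - w.snd i := rfl
      rw [this, step_y]
      split_ifs <;> rfl
    rw [lyapunov, dualSq, dualSq, h1, Finset.mul_sum, sub_eq_add_neg, ← Finset.sum_neg_distrib,
      add_assoc, add_assoc, ← Finset.sum_add_distrib, ← Finset.sum_add_distrib]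
    congr 1
    refine Finset.sum_congr rfl fun i _ => ?_
    rw [step_increment, h2]
    split_ifs
    · ring
    · simp
      ring
  have hcur : lyapunov A p σ τ d (s.pair - w)
        - lyapunov A p σ τ d (WithLp.toLp 2 (s.x - x', 0))
      = τ⁻¹ * (‖s.x - w.fst‖ ^ 2 - ‖s.x - x'‖ ^ 2)
        - 2 * ∑ i, (p i)⁻¹ * ⟪A i (x' - w.fst), d i⟫_ℝ
        + ∑ i, (p i)⁻¹ * ((σ i)⁻¹ * ‖(s.y - w.snd) i‖ ^ 2) := by
    have h1 : (s.pair - w).fst = s.x - w.fst := rfl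
    have h2 : (s.pair - w).snd = s.y - w.snd := rfl
    have h3 : dualSq p σ (0 : PiLp 2 Y) = 0 := by simp [dualSq]
    have h4 : x' - w.fst = (s.x - w.fst) - (s.x - x') := by abel
    have h5 : ∑ i, (p i)⁻¹ * ⟪A i (x' - w.fst), d i⟫_ℝ
        = ∑ i, (p i)⁻¹ * ⟪A i (s.x - w.fst), d i⟫_ℝ - ∑ i, (p i)⁻¹ * ⟪A i (s.x - x'), d i⟫_ℝ := by
      rw [h4, ← Finset.sum_sub_distrib]
      refine Finset.sum_congr rfl fun i _ => ?_
      rw [map_sub (A i), inner_sub_left]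
      ring
    simp only [lyapunov, h1, h2, h3, WithLp.toLp_fst, WithLp.toLp_snd]
    rw [h5]
    simp only [dualSq, mul_assoc]
    ring
  simp only [hstep, mul_add, Finset.sum_add_distrib, ← Finset.sum_mul, hsum, one_mul]
  rw [sum_mul_sum_ite hp hsum, hcur]
  have := Finset.sum_le_sum fun i (_ : i ∈ Finset.univ) => hdual i
  rw [← Finset.mul_sum] at this
  linarith

/-- Subtracting a multiple of the squared last increment from the Lyapunov functional makes the
expected size of the next increment appear in the decrease: this controls the trial points of
all blocks, not only that of the selected one. -/
theorem sum_reduced_lyapunov_step_le (hf : ∀ i, ConvexProperLsc (f i)) (hg : ConvexProperLsc g)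
    (hp : ∀ i, 0 < p i) (hsum : ∑ i, p i = 1) (hσ : ∀ i, 0 < σ i) (hτ : 0 < τ)
    {c : ℝ} (hc : IsCoercivityConstant A p σ τ c)
    {w : WithLp 2 (X × PiLp 2 Y)} (hw : IsSaddlePoint A f g w) {s : State X Y}
    (hs : s.IsConsistent A p) :
    ∑ j, p j * (lyapunov A p σ τ
        ((step A f g p σ τ s j).y - (step A f g p σ τ s j).yOld) ((step A f g p σ τ s j).pair - w)
          - c * ‖(step A f g p σ τ s j).y - (step A f g p σ τ s j).yOld‖ ^ 2)
      ≤ (lyapunov A p σ τ (s.y - s.yOld) (s.pair - w) - c * ‖s.y - s.yOld‖ ^ 2)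
        - c * (‖s.x - nextPrimal g τ s‖ ^ 2
          + ∑ i, p i * ‖(trialDual A f g σ τ s - s.y) i‖ ^ 2) := by
  have h1 := sum_lyapunov_step_le hf hg hp hsum hσ hτ hw hs
  have h2 := hc.le_lyapunov hs.subsingleton (WithLp.toLp 2 (s.x - nextPrimal g τ s, 0))
  rw [WithLp.prod_norm_sq_eq_of_L2] at h2
  simp only [WithLp.toLp_fst, WithLp.toLp_snd, norm_zero] at h2
  have h3 : ∀ j, ‖(step A f g p σ τ s j).y - (step A f g p σ τ s j).yOld‖ ^ 2
      = ‖(trialDual A f g σ τ s - s.y) j‖ ^ 2 := by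
    intro j
    rw [PiLp.norm_sq_eq_of_L2, Finset.sum_eq_single j]
    · rw [step_increment, if_pos rfl]
    · intro i _ hij
      rw [step_increment, if_neg hij]
      simp
    · simp
  simp only [mul_sub, Finset.sum_sub_distrib, h3]
  have h4 : ∑ j, p j * (c * ‖(trialDual A f g σ τ s - s.y) j‖ ^ 2)
      = c * ∑ i, p i * ‖(trialDual A f g σ τ s - s.y) i‖ ^ 2 := by
    rw [Finset.mul_sum]
    exact Finset.sum_congr rfl fun i _ => by ring
  rw [h4]
  nlinarith

/-- A limit of states along which the trial steps vanish is a saddle point, because the graphs of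
the subdifferentials are closed. -/
theorem isSaddlePoint_of_tendsto (hf : ∀ i, ConvexProperLsc (f i)) (hg : ConvexProperLsc g)
    (hσ : ∀ i, 0 < σ i) (hτ : 0 < τ) {ι : Type*} {l : Filter ι} [l.NeBot]
    {S : ι → State X Y} (hS : ∀ k, (S k).IsConsistent A p) {w : WithLp 2 (X × PiLp 2 Y)}
    (hw : Tendsto (fun k => (S k).pair) l (𝓝 w))
    (hd : Tendsto (fun k => (S k).y - (S k).yOld) l (𝓝 0))
    (hx : Tendsto (fun k => (S k).x - nextPrimal g τ (S k)) l (𝓝 0))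
    (ht : Tendsto (fun k => trialDual A f g σ τ (S k) - (S k).y) l (𝓝 0)) :
    IsSaddlePoint A f g w := by
  have hxw : Tendsto (fun k => (S k).x) l (𝓝 w.fst) :=
    ((WithLp.prod_continuous_ofLp 2 X (PiLp 2 Y)).fst.tendsto w).comp hw
  have hyw : Tendsto (fun k => (S k).y) l (𝓝 w.snd) :=
    ((WithLp.prod_continuous_ofLp 2 X (PiLp 2 Y)).snd.tendsto w).comp hw
  have hx' : Tendsto (fun k => nextPrimal g τ (S k)) l (𝓝 w.fst) := by
    simpa using hxw.sub hx
  have ht' : Tendsto (fun k => trialDual A f g σ τ (S k)) l (𝓝 w.snd) := by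
    simpa using ht.add hyw
  have hcont : Continuous (adjointSum A) := LinearMap.continuous_of_finiteDimensional _
  have hzbar : Tendsto (fun k => (S k).zbar) l (𝓝 (adjointSum A w.snd)) := by
    simp only [(hS _).zbar_eq]
    have h1 : Continuous fun d : PiLp 2 Y =>
        adjointSum A (WithLp.toLp 2 fun i => (p i)⁻¹ • d i) := hcont.comp (by fun_prop)
    have h2 := (h1.tendsto 0).comp hd
    have h3 : (WithLp.toLp 2 fun i => (p i)⁻¹ • (0 : PiLp 2 Y) i : PiLp 2 Y) = 0 := by
      ext i
      simp
    rw [h3, map_zero] at h2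
    simpa using ((hcont.tendsto _).comp hyw).add h2
  refine (isSaddlePoint_iff hf hg).2 ⟨?_, fun i => ?_⟩
  · refine IsSubgradient.of_tendsto hg (fun k => isSubgradient_nextPrimal hg hτ (S k)) hx' ?_
    simpa using (hx.const_smul τ⁻¹).sub hzbar
  · have hev : Continuous fun y : PiLp 2 Y => y i := by fun_prop
    refine IsSubgradient.of_tendsto (hf i).conj
      (fun k => isSubgradient_trialDual (A := A) (g := g) (τ := τ) hf hσ (S k) i)
      ((hev.tendsto _).comp ht') ?_
    have h1 := ((hev.tendsto _).comp ht.neg).const_smul (σ i)⁻¹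
    have h2 := h1.add (((A i).continuous.tendsto _).comp hx')
    simpa [Function.comp_def] using h2

end Algorithm

/-! ### Almost sure convergence of the iterates -/

section Convergence

variable {n : ℕ} {X : Type*} [NormedAddCommGroup X] [InnerProductSpace ℝ X]
  [FiniteDimensional ℝ X] {Y : Fin n → Type*} [∀ i, NormedAddCommGroup (Y i)]
  [∀ i, InnerProductSpace ℝ (Y i)] [∀ i, FiniteDimensional ℝ (Y i)]
  {A : ∀ i, X →L[ℝ] Y i} {f : ∀ i, Y i → EReal} {g : X → EReal} {p σ : Fin n → ℝ} {τ : ℝ}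
  {x₀ : X}

theorem isConsistent_run (s : ℕ → Fin n) (k : ℕ) :
    (run A f g p σ τ x₀ s k).IsConsistent A p := by
  induction k with
  | zero => exact isConsistent_init x₀
  | succ k ih => exact ih.step (s k)

theorem dependsOn_run (k : ℕ) : DependsOn (fun s => run A f g p σ τ x₀ s k) (Set.Iio k) := by
  induction k with
  | zero => exact fun s s' _ => rfl
  | succ k ih =>
    intro s s' hss
    simp only [run]
    rw [hss k (Nat.lt_succ_self k)]
    exact congrArg (fun t => step A f g p σ τ t (s' k))
      (ih fun l hl => hss l (lt_trans hl (Nat.lt_succ_self k)))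

theorem run_update_succ (s : ℕ → Fin n) (k : ℕ) (i : Fin n) :
    run A f g p σ τ x₀ (Function.update s k i) (k + 1)
      = step A f g p σ τ (run A f g p σ τ x₀ s k) i := by
  rw [run, Function.update_self]
  congr 1
  exact dependsOn_run k fun l hl => Function.update_of_ne (ne_of_lt hl) _ _

theorem tendsto_zero_of_summable_sq {E : Type*} [SeminormedAddCommGroup E] {u : ℕ → E} {b : ℕ → ℝ}
    (hb : Summable b) {c : ℝ} (hc : 0 < c) (h : ∀ k, c * ‖u k‖ ^ 2 ≤ b k) :
    Tendsto u atTop (𝓝 0) := by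
  have h1 : Tendsto (fun k => ‖u k‖ ^ 2) atTop (𝓝 0) := by
    refine squeeze_zero (fun k => sq_nonneg _) (fun k => ?_)
      (by simpa using hb.tendsto_atTop_zero.const_mul c⁻¹)
    rw [le_inv_mul_iff₀ hc]
    exact h k
  rw [tendsto_zero_iff_norm_tendsto_zero]
  simpa using h1.sqrt

theorem sum_eq_one_of_law {Ω : Type*} [MeasurableSpace Ω] {P : Measure Ω} [IsProbabilityMeasure P]
    {j : Ω → Fin n} (hj : Measurable j) (hp : ∀ i, 0 ≤ p i)
    (hlaw : ∀ i, P {ω | j ω = i} = ENNReal.ofReal (p i)) : ∑ i, p i = 1 := by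
  have h1 : ∑ i, P (j ⁻¹' {i}) = P Set.univ := by
    have := sum_measure_preimage_singleton (μ := P) (f := j) Finset.univ
      fun i _ => hj (measurableSet_singleton i)
    simpa using this
  have h2 : ∑ i, P (j ⁻¹' {i}) = ENNReal.ofReal (∑ i, p i) := by
    rw [ENNReal.ofReal_sum_of_nonneg fun i _ => hp i]
    exact Finset.sum_congr rfl fun i _ => hlaw i
  rw [h2, measure_univ, ENNReal.ofReal_eq_one] at h1
  exact h1

/-- For a fixed saddle point, the Lyapunov functional converges and all trial steps vanish, almost
surely. -/
theorem ae_tendsto_lyapunov (hf : ∀ i, ConvexProperLsc (f i)) (hg : ConvexProperLsc g)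
    (hp : ∀ i, 0 < p i) (hσ : ∀ i, 0 < σ i) (hτ : 0 < τ)
    {c : ℝ} (hc : IsCoercivityConstant A p σ τ c)
    {Ω : Type*} [MeasurableSpace Ω] {P : Measure Ω} [IsProbabilityMeasure P]
    {j : ℕ → Ω → Fin n} (hj : ∀ k, Measurable (j k)) (hindep : iIndepFun j P)
    (hlaw : ∀ k i, P {ω | j k ω = i} = ENNReal.ofReal (p i))
    {w : WithLp 2 (X × PiLp 2 Y)} (hw : IsSaddlePoint A f g w) :
    ∀ᵐ ω ∂P, ∀ S : ℕ → State X Y, (∀ k, S k = run A f g p σ τ x₀ (fun l => j l ω) k) →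
      (∃ a : ℝ, Tendsto (fun k => lyapunov A p σ τ ((S k).y - (S k).yOld) ((S k).pair - w))
        atTop (𝓝 a)) ∧
      Tendsto (fun k => (S k).y - (S k).yOld) atTop (𝓝 0) ∧
      Tendsto (fun k => (S k).x - nextPrimal g τ (S k)) atTop (𝓝 0) ∧
      Tendsto (fun k => trialDual A f g σ τ (S k) - (S k).y) atTop (𝓝 0) := by
  have hsum := sum_eq_one_of_law (hj 0) (fun i => (hp i).le) (hlaw 0)
  have key := ae_tendsto_and_summable (fun i => (hp i).le) hsum hj hindep hlaw
    (U := fun k s => lyapunov A p σ τ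
        ((run A f g p σ τ x₀ s k).y - (run A f g p σ τ x₀ s k).yOld)
        ((run A f g p σ τ x₀ s k).pair - w)
      - c * ‖(run A f g p σ τ x₀ s k).y - (run A f g p σ τ x₀ s k).yOld‖ ^ 2)
    (D := fun k s => c * (‖(run A f g p σ τ x₀ s k).x - nextPrimal g τ (run A f g p σ τ x₀ s k)‖ ^ 2
      + ∑ i, p i * ‖(trialDual A f g σ τ (run A f g p σ τ x₀ s k)
        - (run A f g p σ τ x₀ s k).y) i‖ ^ 2))
    (fun k s s' hss => by
      have := dependsOn_run (A := A) (f := f) (g := g) (p := p) (σ := σ) (τ := τ) (x₀ := x₀) k hss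
      simp only at this ⊢
      rw [this])
    (fun k s s' hss => by
      have := dependsOn_run (A := A) (f := f) (g := g) (p := p) (σ := σ) (τ := τ) (x₀ := x₀) k hss
      simp only at this ⊢
      rw [this])
    (fun k s => by
      have := hc.le_lyapunov (isConsistent_run (A := A) (f := f) (g := g) (p := p) (σ := σ)
        (τ := τ) (x₀ := x₀) s k).subsingleton ((run A f g p σ τ x₀ s k).pair - w)
      have h1 := mul_nonneg hc.pos.le (sq_nonneg ‖(run A f g p σ τ x₀ s k).pair - w‖)
      linarith)
    (fun k s => mul_nonneg hc.pos.le (add_nonneg (sq_nonneg _)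
      (Finset.sum_nonneg fun i _ => mul_nonneg (hp i).le (sq_nonneg _))))
    (fun k s => by
      simp only [run_update_succ]
      exact sum_reduced_lyapunov_step_le hf hg hp hsum hσ hτ hc hw (isConsistent_run s k))
  filter_upwards [key] with ω hω S hS
  simp only [← hS] at hω
  obtain ⟨⟨a, ha⟩, hD⟩ := hω
  have hterm : ∀ k i, 0 ≤ p i * ‖(trialDual A f g σ τ (S k) - (S k).y) i‖ ^ 2 :=
    fun k i => mul_nonneg (hp i).le (sq_nonneg _)
  have hx : Tendsto (fun k => (S k).x - nextPrimal g τ (S k)) atTop (𝓝 0) :=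
    tendsto_zero_of_summable_sq hD hc.pos fun k => mul_le_mul_of_nonneg_left
      (le_add_of_nonneg_right (Finset.sum_nonneg fun i _ => hterm k i)) hc.pos.le
  have ht : Tendsto (fun k => trialDual A f g σ τ (S k) - (S k).y) atTop (𝓝 0) := by
    have h1 : ∀ i, Tendsto (fun k => (trialDual A f g σ τ (S k) - (S k).y) i) atTop (𝓝 0) := by
      refine fun i => tendsto_zero_of_summable_sq hD (mul_pos hc.pos (hp i)) fun k => ?_
      rw [mul_assoc]
      refine mul_le_mul_of_nonneg_left ?_ hc.pos.le
      have h2 := Finset.single_le_sum (fun l _ => hterm k l) (Finset.mem_univ i)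
      linarith [sq_nonneg ‖(S k).x - nextPrimal g τ (S k)‖]
    exact ((PiLp.continuous_toLp 2 Y).tendsto 0).comp (tendsto_pi_nhds.2 h1)
  have hd : Tendsto (fun k => (S k).y - (S k).yOld) atTop (𝓝 0) := by
    rw [← tendsto_add_atTop_iff_nat 1]
    refine squeeze_zero_norm (fun k => ?_) (by simpa using ht.norm)
    have hk : S (k + 1) = step A f g p σ τ (S k) (j k ω) := by rw [hS, hS, run]
    rw [hk, PiLp.norm_eq_of_L2, PiLp.norm_eq_of_L2]
    refine Real.sqrt_le_sqrt (Finset.sum_le_sum fun i _ => ?_)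
    rw [step_increment]
    split_ifs
    · exact le_rfl
    · simp
  refine ⟨⟨a, ?_⟩, hd, hx, ht⟩
  have h1 := ha.add ((hd.norm.pow 2).const_mul c)
  simpa using h1

/-- Almost surely the iterates converge to a saddle point. Every cluster point of the iterates is a
saddle point; an argument of Opial type, with the Lyapunov functionals of a countable dense set of
saddle points, shows that there is only one. -/
theorem ae_exists_tendsto_saddlePoint (hf : ∀ i, ConvexProperLsc (f i)) (hg : ConvexProperLsc g)
    (hp : ∀ i, 0 < p i) (hσ : ∀ i, 0 < σ i) (hτ : 0 < τ)
    (hstep : ∀ i, τ * σ i * ‖A i‖ ^ 2 < p i)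
    {Ω : Type*} [MeasurableSpace Ω] {P : Measure Ω} [IsProbabilityMeasure P]
    {j : ℕ → Ω → Fin n} (hj : ∀ k, Measurable (j k)) (hindep : iIndepFun j P)
    (hlaw : ∀ k i, P {ω | j k ω = i} = ENNReal.ofReal (p i))
    (hw : ∃ w, IsSaddlePoint A f g w) :
    ∀ᵐ ω ∂P, ∃ w, IsSaddlePoint A f g w ∧
      Tendsto (iterate A f g p σ τ x₀ fun l => j l ω) atTop (𝓝 w) ∧
      Tendsto (dualIncrement A f g p σ τ x₀ fun l => j l ω) atTop (𝓝 0) := by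
  obtain ⟨c, hc⟩ := exists_isCoercivityConstant hp hσ hτ hstep
  obtain ⟨w₀, hw₀⟩ := hw
  obtain ⟨T, hTsub, hTc, hTdense⟩ :=
    (TopologicalSpace.IsSeparable.of_separableSpace
      {w | IsSaddlePoint A f g w}).exists_countable_dense_subset
  obtain ⟨v₀, hv₀⟩ : T.Nonempty := by
    rw [← closure_nonempty_iff]
    exact ⟨w₀, hTdense hw₀⟩
  have hall := (ae_ball_iff hTc).2 fun v hv =>
    ae_tendsto_lyapunov (x₀ := x₀) hf hg hp hσ hτ hc hj hindep hlaw (hTsub hv)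
  filter_upwards [hall] with ω hω
  set S : ℕ → State X Y := run A f g p σ τ x₀ fun l => j l ω with hS
  have hcons : ∀ k, (S k).IsConsistent A p := isConsistent_run _
  have hlyap := fun v hv => (hω v hv S fun k => rfl).1
  obtain ⟨-, hd, hx, ht⟩ := hω v₀ hv₀ S fun k => rfl
  have hle : ∀ v k, c * ‖(S k).pair - v‖ ^ 2
      ≤ lyapunov A p σ τ ((S k).y - (S k).yOld) ((S k).pair - v) := by
    intro v k
    have h1 := hc.le_lyapunov (hcons k).subsingleton ((S k).pair - v)
    have h2 := mul_nonneg hc.pos.le (sq_nonneg ‖(S k).y - (S k).yOld‖)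
    linarith
  -- a cluster point
  obtain ⟨w, φ, hφ, hwφ⟩ : ∃ w, ∃ φ : ℕ → ℕ, StrictMono φ ∧
      Tendsto (fun k => (S (φ k)).pair) atTop (𝓝 w) := by
    obtain ⟨a, ha⟩ := hlyap v₀ hv₀
    obtain ⟨B, hB⟩ := ha.bddAbove_range
    have hbdd : ∀ k, (S k).pair ∈ Metric.closedBall v₀ (√(c⁻¹ * B)) := by
      intro k
      rw [Metric.mem_closedBall, dist_eq_norm]
      refine Real.le_sqrt_of_sq_le ?_
      rw [le_inv_mul_iff₀ hc.pos]
      exact (hle v₀ k).trans (hB ⟨k, rfl⟩)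
    have := FiniteDimensional.proper_real (WithLp 2 (X × PiLp 2 Y))
    obtain ⟨w, -, φ, hφ, h⟩ := tendsto_subseq_of_bounded Metric.isBounded_closedBall hbdd
    exact ⟨w, φ, hφ, h⟩
  have hφ' := hφ.tendsto_atTop
  have hw : IsSaddlePoint A f g w := isSaddlePoint_of_tendsto hf hg hσ hτ (fun k => hcons (φ k)) hwφ
    (hd.comp hφ') (hx.comp hφ') (ht.comp hφ')
  -- the limit of the Lyapunov functional is identified along the subsequence
  have hlim : ∀ v ∈ T, Tendsto
      (fun k => lyapunov A p σ τ ((S k).y - (S k).yOld) ((S k).pair - v)) atTop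
      (𝓝 (lyapunov A p σ τ 0 (w - v))) := by
    intro v hv
    obtain ⟨a, ha⟩ := hlyap v hv
    have h1 : Tendsto (fun k => lyapunov A p σ τ ((S (φ k)).y - (S (φ k)).yOld)
        ((S (φ k)).pair - v)) atTop (𝓝 (lyapunov A p σ τ 0 (w - v))) :=
      tendsto_lyapunov (hd.comp hφ') (hwφ.sub_const v)
    rwa [← tendsto_nhds_unique (ha.comp hφ') h1]
  have hconv : Tendsto (fun k => (S k).pair) atTop (𝓝 w) := by
    rw [Metric.tendsto_atTop']
    intro ε hε
    have hsmall : ∀ᶠ v in 𝓝 w, lyapunov A p σ τ 0 (w - v) < c * (ε / 2) ^ 2 ∧ dist v w < ε / 2 := by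
      have h1 : Tendsto (fun v => lyapunov A p σ τ 0 (w - v)) (𝓝 w) (𝓝 0) := by
        have h2 := tendsto_lyapunov (A := A) (p := p) (σ := σ) (τ := τ)
          (tendsto_const_nhds (x := (0 : PiLp 2 Y))) ((tendsto_id (x := 𝓝 w)).const_sub w)
        simpa [lyapunov, dualSq] using h2
      exact (h1.eventually (gt_mem_nhds (mul_pos hc.pos (by positivity)))).and
        (Metric.ball_mem_nhds w (half_pos hε))
    obtain ⟨v, ⟨hv1, hv2⟩, hvT⟩ :=
      ((mem_closure_iff_frequently.1 (hTdense hw)).and_eventually hsmall).exists.imp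
        fun v hv => hv.symm
    obtain ⟨N, hN⟩ := eventually_atTop.1 ((hlim v hvT).eventually (gt_mem_nhds hv1))
    refine ⟨N, fun k hk => ?_⟩
    have h1 : ‖(S k).pair - v‖ ^ 2 < (ε / 2) ^ 2 :=
      lt_of_mul_lt_mul_left ((hle v k).trans_lt (hN k hk.le)) hc.pos.le
    have h2 : dist (S k).pair v < ε / 2 := by
      rw [dist_eq_norm]
      exact lt_of_pow_lt_pow_left₀ 2 (by positivity) h1
    linarith [dist_triangle (S k).pair v w]
  exact ⟨w, hw, hconv, hd⟩

end Convergence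

end SPDHG

theorem proposition1 {n : ℕ}
    {X : Type*} [NormedAddCommGroup X] [InnerProductSpace ℝ X] [FiniteDimensional ℝ X]
    {Y : Fin n → Type*} [∀ i, NormedAddCommGroup (Y i)] [∀ i, InnerProductSpace ℝ (Y i)]
    [∀ i, FiniteDimensional ℝ (Y i)]
    (A : ∀ i, X →L[ℝ] Y i) (f : ∀ i, Y i → EReal) (g : X → EReal)
    (hf : ∀ i, SPDHG.ConvexProperLsc (f i)) (hg : SPDHG.ConvexProperLsc g)
    -- step sizes and selection probabilities
    (p σ : Fin n → ℝ) (τ : ℝ) (hp : ∀ i, 0 < p i) (hσ : ∀ i, 0 < σ i) (hτ : 0 < τ)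
    (hstep : ∀ i, τ * σ i * ‖A i‖ ^ 2 < p i)
    -- independent random selections with law `p`
    {Ω : Type*} [MeasurableSpace Ω] (P : Measure Ω) [IsProbabilityMeasure P]
    (j : ℕ → Ω → Fin n) (hj_meas : ∀ k, Measurable (j k)) (hj_indep : iIndepFun j P)
    (hj_law : ∀ k i, P {ω | j k ω = i} = ENNReal.ofReal (p i))
    -- initial point and iterates
    (x₀ : X) (w : ℕ → Ω → WithLp 2 (X × PiLp 2 Y))
    (hw : ∀ k ω, w k ω = SPDHG.iterate A f g p σ τ x₀ (fun l => j l ω) k)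
    -- a saddle point
    (wHat : WithLp 2 (X × PiLp 2 Y)) (hwHat : SPDHG.IsSaddlePoint A f g wHat) :
    (∀ᵐ ω ∂P, Bornology.IsBounded (Set.range fun k => w k ω)) ∧
    (∀ᵐ ω ∂P, ∃ a : ℝ, Tendsto (fun k => SPDHG.lyapunov A p σ τ
        (SPDHG.dualIncrement A f g p σ τ x₀ (fun l => j l ω) k) (w k ω - wHat)) atTop (𝓝 a)) ∧
    (∀ᵐ ω ∂P, ∃ a : ℝ, Tendsto (fun k => ‖w k ω - wHat‖) atTop (𝓝 a)) ∧
    ((∀ᵐ ω ∂P, ∀ c, MapClusterPt c atTop (fun k => w k ω) → SPDHG.IsSaddlePoint A f g c) →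
      ∀ᵐ ω ∂P, ∃ c, SPDHG.IsSaddlePoint A f g c ∧
        Tendsto (fun k => w k ω) atTop (𝓝 c)) := by

  obtain rfl : w = fun k ω => SPDHG.iterate A f g p σ τ x₀ (fun l => j l ω) k := by
    ext1 k
    ext1 ω
    exact hw k ω
  have key := SPDHG.ae_exists_tendsto_saddlePoint (x₀ := x₀) hf hg hp hσ hτ hstep hj_meas hj_indep
    hj_law ⟨wHat, hwHat⟩
  refine ⟨?_, ?_, ?_, fun _ => ?_⟩
  · filter_upwards [key] with ω ⟨c, _, hc, _⟩
    exact Metric.isBounded_range_of_tendsto _ hc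
  · filter_upwards [key] with ω ⟨c, _, hc, hd⟩
    exact ⟨_, SPDHG.tendsto_lyapunov hd (hc.sub_const wHat)⟩
  · filter_upwards [key] with ω ⟨c, _, hc, _⟩
    exact ⟨_, (hc.sub_const wHat).norm⟩
  · filter_upwards [key] with ω ⟨c, hsaddle, hc, _⟩
    exact ⟨c, hsaddle, hc⟩
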